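/- Let $S$ be a Polish space and $\mu$ a Borel probability measure on $S$; functions are identified when they agree $\mu$-a.e. Let $L_{\log}$ be the algebra of all complex measurable $f$ with $\int\log_+|f|\,d\mu<\infty$, with the topology given by the F-norm $f\mapsto\int\log(1+|f|)\,d\mu$. Let $H$ be a closed complex subalgebra of $L_{\log}$ containing the constants, and suppose that $H$ is of Dirichlet type: for every invertible $f\in L_{\log}$ there is $g\in H$, invertible in $H$, with $|g|=|f|$ a.e. Put $H_p=H\cap L_p(\mu)$ and let $\mathcal R$ be the orthogonal projection of $L_2(\mu)$ onto $H_2$. For a real measurable function $v$ let $L_2(e^{v})$ be the weighted space with norm $\|f\|_{L_2(e^v)}=\left(\int|f|^2e^{v}\,d\mu\right)^{1/2}$, and let $$\|\mathcal R\|_{L_2(e^v)}=\sup\{\|\mathcal Rf\|_{L_2(e^v)}: f\in L_2(\mu)\cap L_2(e^v),\ \|f\|_{L_2(e^v)}\le 1\}.$$ A real function $w$ is called an $\mathcal R$-weight direction if $\|\mathcal R\|_{L_2(e^{\alpha w})}<\infty$ for some $\alpha>0$, and one sets $\|w\|_{\mathcal D(\mathcal R)}=\inf\{t>0:\|\mathcal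 R\|_{L_2(e^{w/t})}\le e\}$ (with $\inf\emptyset=\infty$). A real $w\in L_1(\mu)$ is said to be in $BMO$ if $w\in H_1+L_\infty$, and $\|w\|_{BMO}=\inf\{\|w-h\|_\infty:h\in H_1\}$. Proposition 5.4. Let $w\in L_1(\mu)$ be real. Then $w\in BMO$ if and only if $w$ is an $\mathcal R$-weight direction. Further, there is a universal constant $C>0$ (independent of $S,\mu,H,w$) such that if $w\in BMO$ then $$C^{-1}\|w\|_{BMO}\le\|w\|_{\mathcal D(\mathcal R)}\le C\|w\|_{BMO}.$$ -/

import Mathlib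

open MeasureTheory
open scoped ENNReal NNReal

noncomputable section

namespace HardyWeights

variable {S : Type*} [MeasurableSpace S] {μ : Measure S}

/-- Membership of a class of measurable functions in `L_log`: `∫ log⁺ |f| dμ < ∞`. -/
def MemLlog (f : S →ₘ[μ] ℂ) : Prop :=
  ∫⁻ x, ENNReal.ofReal (Real.posLog ‖f x‖) ∂μ < ∞

/-- The F-norm `∫ log (1 + |f|) dμ` which gives `L_log` its (metrizable) topology. -/
def llogNorm (f : S →ₘ[μ] ℂ) : ℝ≥0∞ :=
  ∫⁻ x, ENNReal.ofReal (Real.log (1 + ‖f x‖)) ∂μ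

variable (μ) in
/-- A closed subalgebra `H` of `L_log(μ)`, containing the constants: a complex linear subspace
which contains `1`, is closed under products, consists of elements of `L_log`, and to which each
element of `L_log` belongs which is a limit of elements of `H` for the F-norm. -/
structure ClosedSubalgebra extends Submodule ℂ (S →ₘ[μ] ℂ) where
  one_mem : (1 : S →ₘ[μ] ℂ) ∈ toSubmodule
  mul_mem : ∀ f ∈ toSubmodule, ∀ g ∈ toSubmodule, f * g ∈ toSubmodule
  memLlog : ∀ f ∈ toSubmodule, MemLlog f
  closed : ∀ f : S →ₘ[μ] ℂ, MemLlog f →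
    (∀ ε : ℝ≥0∞, 0 < ε → ∃ g ∈ toSubmodule, llogNorm (f - g) < ε) → f ∈ toSubmodule

namespace ClosedSubalgebra

/-- `H` is of Dirichlet type: for each invertible element `f` of the algebra `L_log` there is an
invertible element `g` of `H` (that is, with its inverse in `H`) such that `|g| = |f|` a.e. -/
def IsDirichletType (H : ClosedSubalgebra μ) : Prop :=
  ∀ f f' : S →ₘ[μ] ℂ, MemLlog f → MemLlog f' → f * f' = 1 →
    ∃ g ∈ H.toSubmodule, ∃ g' ∈ H.toSubmodule, g * g' = 1 ∧ ∀ᵐ x ∂μ, ‖g x‖ = ‖f x‖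

/-- The Hardy space `H₂ = H ∩ L₂`, as a linear subspace of `L₂(μ)`. -/
def hardyTwo (H : ClosedSubalgebra μ) : Submodule ℂ (Lp ℂ 2 μ) where
  carrier := {f | (f : S →ₘ[μ] ℂ) ∈ H.toSubmodule}
  add_mem' := fun {_ _} hf hg => H.toSubmodule.add_mem hf hg
  zero_mem' := H.toSubmodule.zero_mem
  smul_mem' := fun c _ hf => H.toSubmodule.smul_mem c hf

theorem posLog_le_self {x : ℝ} (hx : 0 ≤ x) : Real.posLog x ≤ x := by
  rw [Real.posLog]
  exact max_le hx (Real.log_le_self hx)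

theorem log_one_add_le_self {x : ℝ} (hx : 0 ≤ x) : Real.log (1 + x) ≤ x := by
  have := Real.log_le_sub_one_of_pos (x := 1 + x) (by linarith)
  linarith

theorem lintegral_enorm_le_two [IsProbabilityMeasure μ] (f : Lp ℂ 2 μ) :
    ∫⁻ x, ‖f x‖ₑ ∂μ ≤ eLpNorm f 2 μ := by
  rw [← eLpNorm_one_eq_lintegral_enorm]
  exact eLpNorm_le_eLpNorm_of_exponent_le (by norm_num) (Lp.aestronglyMeasurable f)

theorem memLlog_of_two [IsProbabilityMeasure μ] (f : Lp ℂ 2 μ) : MemLlog (f : S →ₘ[μ] ℂ) := by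
  refine lt_of_le_of_lt (lintegral_mono fun x => ?_)
    (lt_of_le_of_lt (lintegral_enorm_le_two f) (Lp.eLpNorm_lt_top f))
  rw [← ofReal_norm]
  exact ENNReal.ofReal_le_ofReal (posLog_le_self (norm_nonneg _))

theorem llogNorm_le_two [IsProbabilityMeasure μ] (f : Lp ℂ 2 μ) :
    llogNorm (f : S →ₘ[μ] ℂ) ≤ eLpNorm f 2 μ := by
  refine (lintegral_mono fun x => ?_).trans (lintegral_enorm_le_two f)
  rw [← ofReal_norm]
  exact ENNReal.ofReal_le_ofReal (log_one_add_le_self (norm_nonneg _))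

theorem isClosed_hardyTwo [IsProbabilityMeasure μ] (H : ClosedSubalgebra μ) :
    IsClosed (H.hardyTwo : Set (Lp ℂ 2 μ)) := by
  refine isClosed_of_closure_subset fun f hf => ?_
  change (f : S →ₘ[μ] ℂ) ∈ H.toSubmodule
  refine H.closed f (memLlog_of_two f) fun ε hε => ?_
  obtain ⟨g, hg, hfg⟩ := EMetric.mem_closure_iff.1 hf ε hε
  refine ⟨g, hg, lt_of_le_of_lt ?_ hfg⟩
  rw [Lp.edist_def, ← eLpNorm_congr_ae (Lp.coeFn_sub f g)]
  exact llogNorm_le_two (f - g)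

instance [IsProbabilityMeasure μ] (H : ClosedSubalgebra μ) :
    H.hardyTwo.HasOrthogonalProjection :=
  have : CompleteSpace H.hardyTwo := H.isClosed_hardyTwo.completeSpace_coe
  inferInstance

/-- The operator `ℛ`: the orthogonal projection of `L₂(μ)` onto `H₂`. -/
def riesz [IsProbabilityMeasure μ] (H : ClosedSubalgebra μ) : Lp ℂ 2 μ →L[ℂ] Lp ℂ 2 μ :=
  H.hardyTwo.starProjection

/-- `h ∈ H₁ = H ∩ L₁`. -/
def MemHardyOne (H : ClosedSubalgebra μ) (h : S →ₘ[μ] ℂ) : Prop :=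
  h ∈ H.toSubmodule ∧ Integrable h μ

/-- A real function `w` is in `BMO` when `w ∈ H₁ + L_∞` (complex spaces). -/
def MemBMO (H : ClosedSubalgebra μ) (w : S → ℝ) : Prop :=
  ∃ (h : S →ₘ[μ] ℂ) (b : S → ℂ), H.MemHardyOne h ∧ MemLp b ∞ μ ∧
    ∀ᵐ x ∂μ, (w x : ℂ) = h x + b x

/-- `‖w‖_BMO = inf {‖w - h‖_∞ : h ∈ H₁}`. -/
def bmoNorm (H : ClosedSubalgebra μ) (w : S → ℝ) : ℝ≥0∞ :=
  ⨅ (h : S →ₘ[μ] ℂ) (_ : H.MemHardyOne h), eLpNorm (fun x => (w x : ℂ) - h x) ∞ μ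

end ClosedSubalgebra

/-- The norm of `f` in the weighted space `L₂(e^w)`: `(∫ |f|² e^w dμ)^{1/2}`, possibly infinite. -/
def weightedNorm (w : S → ℝ) (f : Lp ℂ 2 μ) : ℝ≥0∞ :=
  (∫⁻ x, ‖f x‖ₑ ^ 2 * ENNReal.ofReal (Real.exp (w x)) ∂μ) ^ (1 / 2 : ℝ)

/-- The norm of `T` on `L₂(e^w)`: the supremum of `‖T f‖` over all `f ∈ L₂ ∩ L₂(e^w)` with
`‖f‖ ≤ 1`, both norms being those of `L₂(e^w)`. -/
def weightedOpNorm (T : Lp ℂ 2 μ →L[ℂ] Lp ℂ 2 μ) (w : S → ℝ) : ℝ≥0∞ :=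
  ⨆ (f : Lp ℂ 2 μ) (_ : weightedNorm w f ≤ 1), weightedNorm w (T f)

/-- `w` is a `T`-weight direction: `T` is bounded on `L₂(e^{αw})` for some `α > 0`. -/
def IsWeightDirection (T : Lp ℂ 2 μ →L[ℂ] Lp ℂ 2 μ) (w : S → ℝ) : Prop :=
  ∃ α : ℝ, 0 < α ∧ weightedOpNorm T (fun x => α * w x) < ∞

/-- `‖w‖_{𝒟(T)} = inf {t > 0 : ‖T‖_{L₂(e^{w/t})} ≤ e}`, which is `∞` when there is no such `t`. -/
def weightDirectionNorm (T : Lp ℂ 2 μ →L[ℂ] Lp ℂ 2 μ) (w : S → ℝ) : ℝ≥0∞ :=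
  ⨅ (t : ℝ) (_ : 0 < t ∧ weightedOpNorm T (fun x => w x / t) ≤ ENNReal.ofReal (Real.exp 1)),
    ENNReal.ofReal t

end HardyWeights

end

/-! Sufficiency rests on a positivity argument. Suppose `h ∈ H₁` is uniformly within 1/4 of the real
function `w`. Then `|Im h| ≤ 1/4`, so `z = e^h` has values in a narrow sector, and `|z| = e^{Re h}`
is comparable with `e^w`. For `p = ℛ f` the product `z p` is formally in `H₂`, while `f - p ⊥ H₂`;
hence `∫ z |p|² = ∫ z p conj f`. The real part of the left side controls `∫ |z| |p|²`, and
Cauchy–Schwarz bounds `ℛ` on `L₂(e^w)`. Since `e^h` may be unbounded, `h` is replaced by `ε⁻¹ sin (ε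
h)`, which is bounded because `h` takes values in a strip (`sqInt_riesz_le_of_sector`,
`sqInt_riesz_le_of_abs_im_le`).

Necessity is a Helson–Szegő argument. Let the weight `ω` lie between positive constants, let `A ≥ 1`
bound the squared norm of `ℛ` on `L₂(ω)`, and put `ρ = √(1 - 1/A) < 1`. The Dirichlet property gives
a unit `g` of `H` with `|g|² = ω`. Boundedness of `ℛ` says that `H₂` and its complement form a
positive angle in `L₂(ω)`; after multiplication by `g` this becomes a bound `ρ` for the Hankel form
of the unimodular function `u = g / conj g`. A Nehari theorem, proved by factorization and
Hahn–Banach, gives `G ∈ H` with `|G - conj u| ≤ ρ`. Then `g² G = ω ζ` with `|ζ - 1| ≤ ρ`, its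
logarithm belongs to `H`, and it differs from `log ω` by the bounded function `log ζ`
(`exists_memFun_near_log`).

A general `e^w` is truncated above and below, which at most doubles `A`. The logarithms of the
truncations converge to `w` in `L₁`, and the uniform distance to `H₁` survives the limit by a
compactness argument for convex sets in `L₂` (`exists_memFun_near_of_approx`). Both estimates are
scale invariant in `w`, which gives the equivalence of the norms. -/

noncomputable section

namespace HardyWeights

open Filter Topology
open scoped ComplexConjugate InnerProductSpace

variable {S : Type*} [MeasurableSpace S] {μ : Measure S}

/-! ### Functional calculus in `H`: dominated limits, exponential and logarithm. -/

namespace ClosedSubalgebra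

/-- A function belongs to `H` when it agrees a.e. with an element of `H`. -/
def MemFun (H : ClosedSubalgebra μ) (f : S → ℂ) : Prop :=
  ∃ F ∈ H.toSubmodule, F =ᵐ[μ] f

variable {H : ClosedSubalgebra μ} {f g : S → ℂ}

theorem MemFun.aestronglyMeasurable (hf : H.MemFun f) : AEStronglyMeasurable f μ := by
  obtain ⟨F, -, hF⟩ := hf
  exact F.aestronglyMeasurable.congr hF

theorem MemFun.congr (hf : H.MemFun f) (h : f =ᵐ[μ] g) : H.MemFun g := by
  obtain ⟨F, hF, hFf⟩ := hf
  exact ⟨F, hF, hFf.trans h⟩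

theorem memFun_coe {F : S →ₘ[μ] ℂ} : H.MemFun F ↔ F ∈ H.toSubmodule := by
  refine ⟨fun ⟨G, hG, h⟩ => ?_, fun h => ⟨F, h, .rfl⟩⟩
  rwa [← AEEqFun.ext h]

theorem MemFun.add (hf : H.MemFun f) (hg : H.MemFun g) : H.MemFun (fun x => f x + g x) := by
  obtain ⟨F, hF, hFf⟩ := hf
  obtain ⟨G, hG, hGg⟩ := hg
  refine ⟨F + G, H.toSubmodule.add_mem hF hG, ?_⟩
  filter_upwards [AEEqFun.coeFn_add F G, hFf, hGg] with x h1 h2 h3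
  simp [h1, h2, h3]

theorem MemFun.mul (hf : H.MemFun f) (hg : H.MemFun g) : H.MemFun (fun x => f x * g x) := by
  obtain ⟨F, hF, hFf⟩ := hf
  obtain ⟨G, hG, hGg⟩ := hg
  refine ⟨F * G, H.mul_mem F hF G hG, ?_⟩
  filter_upwards [AEEqFun.coeFn_mul F G, hFf, hGg] with x h1 h2 h3
  simp [h1, h2, h3]

theorem MemFun.const_mul (hf : H.MemFun f) (c : ℂ) : H.MemFun (fun x => c * f x) := by
  obtain ⟨F, hF, hFf⟩ := hf
  refine ⟨c • F, H.toSubmodule.smul_mem c hF, ?_⟩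
  filter_upwards [AEEqFun.coeFn_smul c F, hFf] with x h1 h2
  simp [h1, h2]

variable (H) in
theorem memFun_const (c : ℂ) : H.MemFun (fun _ => c) := by
  have h : H.MemFun (fun _ => (1 : ℂ)) := ⟨1, H.one_mem, AEEqFun.coeFn_one⟩
  simpa using h.const_mul c

theorem MemFun.sub (hf : H.MemFun f) (hg : H.MemFun g) : H.MemFun (fun x => f x - g x) := by
  simpa [sub_eq_add_neg] using hf.add (hg.const_mul (-1))

theorem MemFun.pow (hf : H.MemFun f) (n : ℕ) : H.MemFun (fun x => f x ^ n) := by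
  induction n with
  | zero => simpa using H.memFun_const 1
  | succ n ih => simpa [pow_succ] using ih.mul hf

theorem memFun_sum {ι : Type*} (s : Finset ι) {f : ι → S → ℂ} (hf : ∀ i ∈ s, H.MemFun (f i)) :
    H.MemFun (fun x => ∑ i ∈ s, f i x) := by
  classical
  induction s using Finset.induction_on with
  | empty => simpa using H.memFun_const 0
  | insert a s ha ih =>
    simp only [Finset.sum_insert ha]
    exact (hf a (by simp)).add (ih fun i hi => hf i (by simp [hi]))

/-- `H` is closed under limits a.e. which are dominated in `L_log`. -/
theorem memFun_of_tendsto_of_dominated {f : ℕ → S → ℂ} {g : S → ℂ} {F : S → ℝ}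
    (hf : ∀ n, H.MemFun (f n)) (hF : ∫⁻ x, ENNReal.ofReal (Real.log (1 + F x)) ∂μ < ∞)
    (hb : ∀ n, ∀ᵐ x ∂μ, ‖f n x‖ ≤ F x)
    (hlim : ∀ᵐ x ∂μ, Tendsto (fun n => f n x) atTop (𝓝 (g x))) : H.MemFun g := by
  have hg : AEStronglyMeasurable g μ :=
    aestronglyMeasurable_of_tendsto_ae atTop (fun n => (hf n).aestronglyMeasurable) hlim
  have hgF : ∀ᵐ x ∂μ, ‖g x‖ ≤ F x := by
    filter_upwards [hlim, ae_all_iff.2 hb] with x hx hbx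
    exact le_of_tendsto hx.norm (Eventually.of_forall hbx)
  refine ⟨AEEqFun.mk g hg, ?_, AEEqFun.coeFn_mk g hg⟩
  refine H.closed _ ?_ ?_
  · refine lt_of_le_of_lt (lintegral_mono_ae ?_) hF
    filter_upwards [AEEqFun.coeFn_mk g hg, hgF] with x hx hxF
    rw [hx]
    refine ENNReal.ofReal_le_ofReal ?_
    have h0 := norm_nonneg (g x)
    rw [Real.posLog]
    refine max_le (Real.log_nonneg (by linarith)) ?_
    rcases h0.eq_or_lt with h | h
    · rw [← h]; simpa using Real.log_nonneg (by linarith)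
    · exact Real.log_le_log h (by linarith)
  · have key : Tendsto (fun n => ∫⁻ x, ENNReal.ofReal (Real.log (1 + ‖g x - f n x‖)) ∂μ) atTop
        (𝓝 (∫⁻ _, 0 ∂μ)) := by
      -- The majorant comes from `1 + 2F ≤ (1 + F)²`.
      refine tendsto_lintegral_of_dominated_convergence'
        (fun x => 2 * ENNReal.ofReal (Real.log (1 + F x))) (fun n => ?_) (fun n => ?_) ?_ ?_
      · have := (hg.sub (hf n).aestronglyMeasurable).norm.aemeasurable
        exact (Real.measurable_log.comp_aemeasurable (this.const_add 1)).ennreal_ofReal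
      · filter_upwards [hb n, hgF] with x h1 h2
        have e : (2 : ℝ≥0∞) = ENNReal.ofReal 2 := by simp
        rw [e, ← ENNReal.ofReal_mul (by norm_num)]
        refine ENNReal.ofReal_le_ofReal ?_
        have h3 := norm_sub_le (g x) (f n x)
        have h4 := norm_nonneg (g x)
        have h5 := norm_nonneg (g x - f n x)
        calc Real.log (1 + ‖g x - f n x‖) ≤ Real.log ((1 + F x) ^ 2) :=
              Real.log_le_log (by linarith) (by nlinarith)
          _ = 2 * Real.log (1 + F x) := by simp [Real.log_pow]
      · rw [lintegral_const_mul' _ _ (by simp)]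
        exact ENNReal.mul_ne_top (by simp) hF.ne
      · filter_upwards [hlim] with x hx
        have h1 : Tendsto (fun n => 1 + ‖g x - f n x‖) atTop (𝓝 1) := by
          have := (tendsto_const_nhds (x := g x)).sub hx
          simpa using (this.norm).const_add 1
        have h2 := (Real.continuousAt_log one_ne_zero).tendsto.comp h1
        have h3 := ENNReal.tendsto_ofReal h2
        simpa using h3
    rw [lintegral_zero] at key
    intro ε hε
    obtain ⟨n, hn⟩ := (key.eventually (gt_mem_nhds hε)).exists
    obtain ⟨G, hG, hGf⟩ := hf n
    refine ⟨G, hG, ?_⟩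
    refine lt_of_le_of_lt (le_of_eq (lintegral_congr_ae ?_)) hn
    filter_upwards [AEEqFun.coeFn_mk g hg, hGf, AEEqFun.coeFn_sub (AEEqFun.mk g hg) G]
      with x h1 h2 h3
    rw [h3, Pi.sub_apply, h1, h2]

/-- `H` is closed under bounded limits a.e. -/
theorem memFun_of_tendsto_of_bounded [IsFiniteMeasure μ] {f : ℕ → S → ℂ} {g : S → ℂ} {B : ℝ}
    (hf : ∀ n, H.MemFun (f n)) (hb : ∀ n, ∀ᵐ x ∂μ, ‖f n x‖ ≤ B)
    (hlim : ∀ᵐ x ∂μ, Tendsto (fun n => f n x) atTop (𝓝 (g x))) : H.MemFun g := by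
  refine memFun_of_tendsto_of_dominated (F := fun _ => B) hf ?_ hb hlim
  rw [lintegral_const]
  exact ENNReal.mul_lt_top (by simp) (measure_lt_top μ _)

/-- The partial sums of the series are dominated by `e^{|f|}`, and `log (1 + e^{|f|}) ≤ log 2 +
|f|`; integrability of `f` therefore makes the convergence dominated in `L_log`, although `e^f` need
not be integrable. -/
theorem MemFun.exp [IsFiniteMeasure μ] (hf : H.MemFun f) (hi : Integrable f μ) :
    H.MemFun (fun x => Complex.exp (f x)) := by
  refine memFun_of_tendsto_of_dominated (F := fun x => Real.exp ‖f x‖)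
    (f := fun n x => ∑ k ∈ Finset.range n, ((k.factorial : ℂ)⁻¹ * f x ^ k))
    (fun n => memFun_sum _ fun k _ => (hf.pow k).const_mul _) ?_ (fun n => ?_) ?_
  · have h1 : Integrable (fun x => Real.log 2 + ‖f x‖) μ := (integrable_const _).add hi.norm
    refine lt_of_le_of_lt (lintegral_mono fun x => ENNReal.ofReal_le_ofReal ?_)
      h1.lintegral_lt_top
    have h2 := Real.one_le_exp (norm_nonneg (f x))
    calc Real.log (1 + Real.exp ‖f x‖) ≤ Real.log (2 * Real.exp ‖f x‖) :=
          Real.log_le_log (by linarith) (by linarith)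
      _ = Real.log 2 + ‖f x‖ := by
          rw [Real.log_mul (by norm_num) (Real.exp_pos _).ne', Real.log_exp]
  · refine Eventually.of_forall fun x => (norm_sum_le _ _).trans ?_
    refine le_trans (Finset.sum_le_sum fun k _ => ?_) (Real.sum_le_exp_of_nonneg (norm_nonneg (f x)) n)
    simp [div_eq_inv_mul]
  · refine Eventually.of_forall fun x => ?_
    have := (NormedSpace.expSeries_div_hasSum_exp (f x)).tendsto_sum_nat
    rw [← Complex.exp_eq_exp_ℂ] at this
    simpa [div_eq_inv_mul] using this

/-- The principal logarithm of a bounded element of `H` with values in a half-plane `Re z ≥ δ`,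
where `δ > 0`. -/
theorem MemFun.log [IsFiniteMeasure μ] (hf : H.MemFun f) {B δ : ℝ} (hδ : 0 < δ)
    (hB : ∀ᵐ x ∂μ, ‖f x‖ ≤ B) (hre : ∀ᵐ x ∂μ, δ ≤ (f x).re) :
    H.MemFun (fun x => Complex.log (f x)) := by
  -- If `|z| ≤ B` and `Re z ≥ δ`, then `|z - l|² ≤ l² - 2lδ + B²`, which is below `l²` for large
  -- `l`. So the values of `f` lie in a disc `|z - l| ≤ r l` with `r < 1`, on which the Taylor
  -- series of the logarithm at `l` converges uniformly.
  obtain ⟨l, hl0, hl⟩ : ∃ l : ℝ, 0 < l ∧ B ^ 2 < 2 * l * δ :=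
    ⟨(B ^ 2 + 1) / (2 * δ), by positivity, by field_simp; linarith⟩
  obtain ⟨r, hr0, hr1, hr⟩ : ∃ r : ℝ, 0 ≤ r ∧ r < 1 ∧ l ^ 2 - 2 * l * δ + B ^ 2 ≤ (r * l) ^ 2 := by
    refine ⟨Real.sqrt (max 0 (1 - (2 * l * δ - B ^ 2) / l ^ 2)), Real.sqrt_nonneg _, ?_, ?_⟩
    · rw [Real.sqrt_lt' one_pos]
      have : 0 < (2 * l * δ - B ^ 2) / l ^ 2 := div_pos (by linarith) (by positivity)
      exact max_lt (by norm_num) (by linarith)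
    · rw [mul_pow, Real.sq_sqrt (le_max_left _ _)]
      calc l ^ 2 - 2 * l * δ + B ^ 2 = (1 - (2 * l * δ - B ^ 2) / l ^ 2) * l ^ 2 := by
            field_simp; ring
        _ ≤ _ := by gcongr; exact le_max_right _ _
  have hq : ∀ᵐ x ∂μ, ‖1 - (l : ℂ)⁻¹ * f x‖ ≤ r := by
    filter_upwards [hB, hre] with x h1 h2
    have e : (1 - (l : ℂ)⁻¹ * f x) = (l : ℂ)⁻¹ * (l - f x) := by
      have : (l : ℂ) ≠ 0 := by exact_mod_cast hl0.ne'
      field_simp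
    have h3 : ‖(l : ℂ) - f x‖ ^ 2 ≤ (r * l) ^ 2 := by
      have h4 : ‖f x‖ ^ 2 ≤ B ^ 2 := by gcongr
      rw [← Complex.normSq_eq_norm_sq, Complex.normSq_apply] at h4 ⊢
      simp only [Complex.sub_re, Complex.sub_im, Complex.ofReal_re, Complex.ofReal_im]
      nlinarith
    have h5 : ‖(l : ℂ) - f x‖ ≤ r * l :=
      (sq_le_sq₀ (norm_nonneg _) (by positivity)).1 h3
    rw [e, norm_mul, norm_inv, Complex.norm_real, Real.norm_of_nonneg hl0.le, inv_mul_le_iff₀ hl0]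
    linarith
  have hq' : H.MemFun (fun x => 1 - (l : ℂ)⁻¹ * f x) := (H.memFun_const 1).sub (hf.const_mul _)
  have hs : Summable fun k : ℕ => r ^ k := summable_geometric_of_lt_one hr0 hr1
  have hlog : H.MemFun (fun x => -Complex.log (1 - (1 - (l : ℂ)⁻¹ * f x))) := by
    refine memFun_of_tendsto_of_bounded (B := ∑' k : ℕ, r ^ k)
      (f := fun n x => ∑ k ∈ Finset.range n, ((k : ℂ)⁻¹ * (1 - (l : ℂ)⁻¹ * f x) ^ k))
      (fun n => memFun_sum _ fun k _ => (hq'.pow k).const_mul _) (fun n => ?_) ?_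
    · filter_upwards [hq] with x hx
      refine (norm_sum_le _ _).trans (le_trans (Finset.sum_le_sum fun k _ => ?_)
        (hs.sum_le_tsum (Finset.range n) fun k _ => by positivity))
      rw [norm_mul, norm_inv, norm_pow, Complex.norm_natCast]
      calc (k : ℝ)⁻¹ * ‖1 - (l : ℂ)⁻¹ * f x‖ ^ k ≤ 1 * r ^ k := by
            gcongr
            rcases Nat.eq_zero_or_pos k with h | h
            · simp [h]
            · exact inv_le_one_of_one_le₀ (by exact_mod_cast h)
        _ = r ^ k := one_mul _
    · filter_upwards [hq] with x hx
      simpa [div_eq_inv_mul] using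
        (Complex.hasSum_taylorSeries_neg_log (hx.trans_lt hr1)).tendsto_sum_nat
  refine ((H.memFun_const (Real.log l)).sub hlog).congr ?_
  filter_upwards [hre] with x hx
  have hne : f x ≠ 0 := fun h => by simp [h] at hx; linarith
  have hl' : (l : ℂ) ≠ 0 := by exact_mod_cast hl0.ne'
  have e : f x = l * ((l : ℂ)⁻¹ * f x) := by field_simp
  conv_rhs => rw [e]
  rw [Complex.log_ofReal_mul hl0 (by simp [hne, hl'])]
  simp

end ClosedSubalgebra

/-! ### Weighted integrals: semicontinuity and truncation. -/

/-- The weighted integral `∫ |f|² ω dμ`. -/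
def sqInt (f : Lp ℂ 2 μ) (ω : S → ℝ) : ℝ≥0∞ :=
  ∫⁻ x, ‖f x‖ₑ ^ 2 * ENNReal.ofReal (ω x) ∂μ

theorem enorm_sq_mul_ofReal (z : ℂ) (r : ℝ) :
    ‖z‖ₑ ^ 2 * ENNReal.ofReal r = ENNReal.ofReal (‖z‖ ^ 2 * r) := by
  rw [ENNReal.ofReal_mul (by positivity), ENNReal.ofReal_pow (norm_nonneg _), ofReal_norm]

theorem aemeasurable_enorm_sq_mul {f : S → ℂ} {ω : S → ℝ} (hf : AEStronglyMeasurable f μ)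
    (hω : AEMeasurable ω μ) : AEMeasurable (fun x => ‖f x‖ₑ ^ 2 * ENNReal.ofReal (ω x)) μ :=
  (hf.enorm.pow_const 2).mul hω.ennreal_ofReal

theorem sqInt_mono {f : Lp ℂ 2 μ} {ω ω' : S → ℝ} (h : ∀ᵐ x ∂μ, ω x ≤ ω' x) :
    sqInt f ω ≤ sqInt f ω' := by
  refine lintegral_mono_ae ?_
  filter_upwards [h] with x hx
  gcongr

theorem sqInt_const_mul (f : Lp ℂ 2 μ) {c : ℝ} (hc : 0 ≤ c) (ω : S → ℝ) :
    sqInt f (fun x => c * ω x) = ENNReal.ofReal c * sqInt f ω := by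
  rw [sqInt, sqInt, ← lintegral_const_mul' _ _ ENNReal.ofReal_ne_top]
  refine lintegral_congr fun x => ?_
  rw [ENNReal.ofReal_mul hc]
  ring

/-- Weighted integrals are lower semicontinuous on `L₂`. -/
theorem sqInt_le_of_tendsto {f : ℕ → Lp ℂ 2 μ} {g : Lp ℂ 2 μ} (hfg : Tendsto f atTop (𝓝 g))
    {ω : S → ℝ} (hω : AEMeasurable ω μ) {C : ℝ≥0∞} (hC : ∀ n, sqInt (f n) ω ≤ C) :
    sqInt g ω ≤ C := by
  obtain ⟨ns, -, hns⟩ := (tendstoInMeasure_of_tendsto_Lp hfg).exists_seq_tendsto_ae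
  calc sqInt g ω
      = ∫⁻ x, liminf (fun n => ‖f (ns n) x‖ₑ ^ 2 * ENNReal.ofReal (ω x)) atTop ∂μ := by
        refine lintegral_congr_ae ?_
        filter_upwards [hns] with x hx
        refine (Tendsto.liminf_eq ?_).symm
        exact ENNReal.Tendsto.mul_const ((ENNReal.continuous_pow 2).tendsto _ |>.comp hx.enorm)
          (Or.inr ENNReal.ofReal_ne_top)
    _ ≤ liminf (fun n => sqInt (f (ns n)) ω) atTop :=
        lintegral_liminf_le' fun n =>
          aemeasurable_enorm_sq_mul (Lp.aestronglyMeasurable _) hω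
    _ ≤ C := by
        refine (liminf_le_liminf (Eventually.of_forall fun n => hC (ns n))).trans ?_
        simp

theorem sqInt_le_liminf (f : Lp ℂ 2 μ) {ω : ℕ → S → ℝ} {ω' : S → ℝ}
    (hω : ∀ n, AEMeasurable (ω n) μ)
    (hlim : ∀ᵐ x ∂μ, Tendsto (fun n => ω n x) atTop (𝓝 (ω' x))) :
    sqInt f ω' ≤ liminf (fun n => sqInt f (ω n)) atTop := by
  calc sqInt f ω'
      = ∫⁻ x, liminf (fun n => ‖f x‖ₑ ^ 2 * ENNReal.ofReal (ω n x)) atTop ∂μ := by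
        refine lintegral_congr_ae ?_
        filter_upwards [hlim] with x hx
        refine (Tendsto.liminf_eq ?_).symm
        exact ENNReal.Tendsto.const_mul (ENNReal.tendsto_ofReal hx) (Or.inr (by simp))
    _ ≤ _ := lintegral_liminf_le' fun n =>
          aemeasurable_enorm_sq_mul (Lp.aestronglyMeasurable _) (hω n)

theorem memLp_bdd_mul {φ f : S → ℂ} (hφ : AEStronglyMeasurable φ μ) {B : ℝ}
    (hB : ∀ᵐ x ∂μ, ‖φ x‖ ≤ B) (hf : MemLp f 2 μ) : MemLp (fun x => φ x * f x) 2 μ := by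
  refine hf.of_le_mul (c := B) (hφ.mul hf.1) ?_
  filter_upwards [hB] with x hx
  rw [norm_mul]
  gcongr

/-- Truncations of `f ∈ L₂` to the sets `{|w| ≤ n}` converge to `f`. -/
theorem exists_truncation (f : Lp ℂ 2 μ) {w : S → ℝ} (hw : AEMeasurable w μ) :
    ∃ F : ℕ → Lp ℂ 2 μ, Tendsto F atTop (𝓝 f) ∧ (∀ n, ∀ᵐ x ∂μ, ‖F n x‖ ≤ ‖f x‖) ∧
      ∀ n : ℕ, ∀ᵐ x ∂μ, F n x ≠ 0 → |w x| ≤ n := by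
  classical
  have hs : ∀ n : ℕ, NullMeasurableSet {x | |w x| ≤ n} μ := fun n =>
    nullMeasurableSet_le hw.abs aemeasurable_const
  have hle : ∀ (n : ℕ) x, ‖({x | |w x| ≤ n} : Set S).indicator f x‖ ≤ ‖f x‖ := fun n x =>
    norm_indicator_le_norm_self _ _
  have hm : ∀ n : ℕ, MemLp (({x | |w x| ≤ n} : Set S).indicator f) 2 μ := fun n =>
    (Lp.memLp f).of_le ((Lp.aestronglyMeasurable f).indicator₀ (hs n))
      (Eventually.of_forall (hle n))
  refine ⟨fun n => (hm n).toLp _, ?_, fun n => ?_, fun n => ?_⟩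
  · have h1 := (Lp.tendsto_Lp_iff_tendsto_eLpNorm'' (fi := atTop) _ hm f (Lp.memLp f)).2 ?_
    · rwa [Lp.toLp_coeFn] at h1
    have h2 : Tendsto (fun n : ℕ => ∫⁻ x, ‖(({x | |w x| ≤ n} : Set S).indicator f - f) x‖ₑ ^ (2 : ℝ) ∂μ)
        atTop (𝓝 (∫⁻ _, 0 ∂μ)) := by
      refine tendsto_lintegral_of_dominated_convergence' (fun x => ‖f x‖ₑ ^ (2 : ℝ))
        (fun n => ((hm n).1.sub (Lp.aestronglyMeasurable f)).enorm.pow_const _) (fun n => ?_) ?_ ?_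
      · refine Eventually.of_forall fun x => ?_
        by_cases h : |w x| ≤ n <;> simp [Set.indicator, h]
      · have := (Lp.memLp f).eLpNorm_lt_top
        rw [eLpNorm_lt_top_iff_lintegral_rpow_enorm_lt_top (by norm_num) (by norm_num)] at this
        simpa using this.ne
      · refine Eventually.of_forall fun x => ?_
        obtain ⟨N, hN⟩ := exists_nat_ge |w x|
        refine tendsto_const_nhds.congr' ?_
        filter_upwards [eventually_ge_atTop N] with n hn
        have : |w x| ≤ n := hN.trans (by exact_mod_cast hn)
        simp [Set.indicator, this]
    rw [lintegral_zero] at h2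
    have h3 := ((ENNReal.continuous_rpow_const (y := (1 / 2 : ℝ))).tendsto 0).comp h2
    rw [ENNReal.zero_rpow_of_pos (by norm_num)] at h3
    refine h3.congr fun n => ?_
    rw [eLpNorm_eq_lintegral_rpow_enorm_toReal (by norm_num) (by norm_num)]
    simp
  · filter_upwards [(hm n).coeFn_toLp] with x hx
    rw [hx]
    exact hle n x
  · filter_upwards [(hm n).coeFn_toLp] with x hx h
    rw [hx] at h
    by_contra hn
    exact h (Set.indicator_of_notMem (s := {x | |w x| ≤ n}) hn _)

/-! ### The positivity estimate for weights `|z|` with `z` in a sector. -/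

namespace ClosedSubalgebra

variable {H : ClosedSubalgebra μ}

theorem mem_hardyTwo {f : Lp ℂ 2 μ} : f ∈ H.hardyTwo ↔ H.MemFun f := memFun_coe.symm

theorem MemFun.toLp_mem {f : S → ℂ} (hf : H.MemFun f) (h2 : MemLp f 2 μ) :
    h2.toLp f ∈ H.hardyTwo :=
  mem_hardyTwo.2 (hf.congr h2.coeFn_toLp.symm)

variable [IsProbabilityMeasure μ]

theorem riesz_mem (f : Lp ℂ 2 μ) : H.riesz f ∈ H.hardyTwo :=
  Submodule.starProjection_apply_mem _ _

/-- `ℛ` is bounded on `L₂(|z|)` for bounded `z ∈ H` with values in a sector around the positive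
half-axis. -/
theorem sqInt_riesz_le_of_sector {z : S → ℂ} (hz : H.MemFun z) {B c : ℝ} (hc : 0 < c)
    (hB : ∀ᵐ x ∂μ, ‖z x‖ ≤ B) (hre : ∀ᵐ x ∂μ, c * ‖z x‖ ≤ (z x).re) (f : Lp ℂ 2 μ) :
    sqInt (H.riesz f) (fun x => ‖z x‖) ≤ ENNReal.ofReal (c⁻¹ ^ 2) * sqInt f (fun x => ‖z x‖) := by
  set p := H.riesz f with hp
  have hzp : MemLp (fun x => z x * p x) 2 μ :=
    memLp_bdd_mul hz.aestronglyMeasurable hB (Lp.memLp p)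
  have hqH : hzp.toLp _ ∈ H.hardyTwo :=
    (hz.mul (mem_hardyTwo.1 (riesz_mem f))).toLp_mem hzp
  set q := hzp.toLp _ with hq
  have hq' : q =ᵐ[μ] fun x => z x * p x := hzp.coeFn_toLp
  have hint : ∀ g : Lp ℂ 2 μ, Integrable (fun x => ‖g x‖ ^ 2 * ‖z x‖) μ := fun g => by
    have h1 := (memLp_two_iff_integrable_sq_norm (Lp.aestronglyMeasurable g)).1 (Lp.memLp g)
    refine (h1.bdd_mul (f := fun x => ‖z x‖) (c := B) hz.aestronglyMeasurable.norm ?_).congr ?_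
    · simpa using hB
    · exact Eventually.of_forall fun x => mul_comm _ _
  -- Orthogonality of `f - p` to `H₂` is tested on `z p`, which is in `H₂` because `z` is bounded
  -- and `H` is an algebra.
  have h1 : inner ℂ p q = inner ℂ f q := by
    have := H.hardyTwo.starProjection_inner_eq_zero f q hqH
    rw [inner_sub_left, sub_eq_zero] at this
    exact this.symm
  have h2 := congrArg RCLike.re h1
  rw [L2.inner_def, L2.inner_def, ← integral_re (L2.integrable_inner p q),
    ← integral_re (L2.integrable_inner f q)] at h2
  have h3 : c * ∫ x, ‖p x‖ ^ 2 * ‖z x‖ ∂μ ≤ ∫ x, RCLike.re (inner ℂ (p x) (q x)) ∂μ := by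
    rw [← integral_const_mul]
    refine integral_mono_ae ((hint p).const_mul c) (L2.integrable_inner p q).re ?_
    filter_upwards [hq', hre] with x hx hrx
    have e : inner ℂ (p x) (q x) = ((‖p x‖ ^ 2 : ℝ) : ℂ) * z x := by
      rw [hx, RCLike.inner_apply, mul_assoc, Complex.mul_conj, Complex.normSq_eq_norm_sq]
      ring
    rw [e]
    simp only [RCLike.re_to_complex, Complex.re_ofReal_mul]
    nlinarith [sq_nonneg ‖p x‖]
  -- The weights in the arithmetic-geometric mean inequality are chosen so that half of the lower
  -- bound `h3` absorbs the term in `p`; this is legitimate since that integral is finite.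
  have h4 : ∫ x, RCLike.re (inner ℂ (f x) (q x)) ∂μ
      ≤ (2 * c)⁻¹ * ∫ x, ‖f x‖ ^ 2 * ‖z x‖ ∂μ + c / 2 * ∫ x, ‖p x‖ ^ 2 * ‖z x‖ ∂μ := by
    rw [← integral_const_mul, ← integral_const_mul,
      ← integral_add ((hint f).const_mul _) ((hint p).const_mul _)]
    refine integral_mono_ae (L2.integrable_inner f q).re
      (((hint f).const_mul _).add ((hint p).const_mul _)) ?_
    filter_upwards [hq'] with x hx
    refine (RCLike.re_le_norm _).trans ((norm_inner_le_norm _ _).trans ?_)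
    rw [hx, norm_mul]
    have h5 : ‖f x‖ * ‖p x‖ ≤ (2 * c)⁻¹ * ‖f x‖ ^ 2 + c / 2 * ‖p x‖ ^ 2 := by
      have : (2 * c)⁻¹ * ‖f x‖ ^ 2 + c / 2 * ‖p x‖ ^ 2 - ‖f x‖ * ‖p x‖
          = (2 * c)⁻¹ * (‖f x‖ - c * ‖p x‖) ^ 2 := by field_simp; ring
      have h6 : 0 ≤ (2 * c)⁻¹ * (‖f x‖ - c * ‖p x‖) ^ 2 := by positivity
      linarith
    calc ‖f x‖ * (‖z x‖ * ‖p x‖) = ‖f x‖ * ‖p x‖ * ‖z x‖ := by ring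
      _ ≤ ((2 * c)⁻¹ * ‖f x‖ ^ 2 + c / 2 * ‖p x‖ ^ 2) * ‖z x‖ := by gcongr
      _ = _ := by ring
  have h5 : ∫ x, ‖p x‖ ^ 2 * ‖z x‖ ∂μ ≤ c⁻¹ ^ 2 * ∫ x, ‖f x‖ ^ 2 * ‖z x‖ ∂μ := by
    have h6 : c / 2 * ∫ x, ‖p x‖ ^ 2 * ‖z x‖ ∂μ ≤ (2 * c)⁻¹ * ∫ x, ‖f x‖ ^ 2 * ‖z x‖ ∂μ := by
      linarith
    calc _ = (2 / c) * (c / 2 * ∫ x, ‖p x‖ ^ 2 * ‖z x‖ ∂μ) := by field_simp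
      _ ≤ (2 / c) * ((2 * c)⁻¹ * ∫ x, ‖f x‖ ^ 2 * ‖z x‖ ∂μ) := by gcongr
      _ = _ := by field_simp
  have h6 : ∀ g : Lp ℂ 2 μ, sqInt g (fun x => ‖z x‖)
      = ENNReal.ofReal (∫ x, ‖g x‖ ^ 2 * ‖z x‖ ∂μ) := fun g => by
    rw [ofReal_integral_eq_lintegral_ofReal (hint g) (Eventually.of_forall fun x => by positivity)]
    exact lintegral_congr fun x => enorm_sq_mul_ofReal _ _
  rw [h6, h6, ← ENNReal.ofReal_mul (by positivity)]
  exact ENNReal.ofReal_le_ofReal h5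

end ClosedSubalgebra

/-! ### Regularization by `ε⁻¹ sin (ε z)`, and boundedness of `ℛ` near `H₁`. -/

theorem re_sin (z : ℂ) : (Complex.sin z).re = Real.sin z.re * Real.cosh z.im := by
  conv_lhs => rw [Complex.sin_eq]
  simp [← Complex.ofReal_sin, ← Complex.ofReal_cosh, ← Complex.ofReal_cos, ← Complex.ofReal_sinh]

theorem im_sin (z : ℂ) : (Complex.sin z).im = Real.cos z.re * Real.sinh z.im := by
  conv_lhs => rw [Complex.sin_eq]
  simp [← Complex.ofReal_sin, ← Complex.ofReal_cosh, ← Complex.ofReal_cos, ← Complex.ofReal_sinh]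

theorem abs_sinh_le_two_mul {t : ℝ} (ht : |t| ≤ 1) : |Real.sinh t| ≤ 2 * |t| := by
  rw [Real.abs_sinh, Real.sinh_eq]
  have h1 := abs_le.1 (Real.abs_exp_sub_one_sub_id_le (x := |t|) (by simpa using ht))
  have h2 := Real.add_one_le_exp (-|t|)
  nlinarith [abs_nonneg t]

theorem cosh_le_three {t : ℝ} (ht : |t| ≤ 1) : Real.cosh t ≤ 3 := by
  rw [← Real.cosh_abs, Real.cosh_eq]
  have h1 : Real.exp |t| ≤ Real.exp 1 := Real.exp_le_exp.2 ht
  have h2 : Real.exp (-|t|) ≤ 1 := Real.exp_le_one_iff.2 (by simp)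
  have := Real.exp_one_lt_d9
  linarith

/-- The regularization must not open the strip too far: `|cos| ≤ 1` and `|sinh t| ≤ 2|t|` near 0
show that it at most doubles the imaginary part, uniformly in `ε`. -/
theorem abs_im_sin_mul_div_le {ε : ℝ} (h0 : 0 < ε) (h1 : ε ≤ 1) {z : ℂ} (hz : |z.im| ≤ 1) :
    |((ε : ℂ)⁻¹ * Complex.sin (ε * z)).im| ≤ 2 * |z.im| := by
  rw [← Complex.ofReal_inv, Complex.im_ofReal_mul, im_sin, Complex.im_ofReal_mul, abs_mul, abs_mul,
    abs_of_pos (inv_pos.2 h0), inv_mul_le_iff₀ h0]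
  have h2 : |ε * z.im| ≤ 1 := by
    rw [abs_mul, abs_of_pos h0]; nlinarith [abs_nonneg z.im]
  have h3 := abs_sinh_le_two_mul h2
  rw [abs_mul ε, abs_of_pos h0] at h3
  have h4 := Real.abs_cos_le_one ((ε : ℂ) * z).re
  nlinarith [abs_nonneg (Real.sinh (ε * z.im))]

/-- The two entries of the minimum serve different ends: `ε⁻¹` makes the exponential of the
regularized function bounded, and `|Re z|` gives a majorant independent of `ε`. -/
theorem abs_re_sin_mul_div_le {ε : ℝ} (h0 : 0 < ε) (h1 : ε ≤ 1) {z : ℂ} (hz : |z.im| ≤ 1) :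
    |((ε : ℂ)⁻¹ * Complex.sin (ε * z)).re| ≤ 3 * min |z.re| ε⁻¹ := by
  rw [← Complex.ofReal_inv, Complex.re_ofReal_mul, re_sin, Complex.re_ofReal_mul,
    Complex.im_ofReal_mul, abs_mul, abs_mul, abs_of_pos (inv_pos.2 h0)]
  have h2 : |ε * z.im| ≤ 1 := by
    rw [abs_mul, abs_of_pos h0]; nlinarith [abs_nonneg z.im]
  have h3 := cosh_le_three h2
  have h3' := Real.cosh_pos (ε * z.im)
  have h4 : ε⁻¹ * |Real.sin (ε * z.re)| ≤ min |z.re| ε⁻¹ := by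
    rw [inv_mul_le_iff₀ h0, mul_min_of_nonneg _ _ h0.le, mul_inv_cancel₀ h0.ne']
    refine le_min ?_ (Real.abs_sin_le_one _)
    have := Real.abs_sin_le_abs (x := ε * z.re)
    rwa [abs_mul ε, abs_of_pos h0] at this
  rw [abs_of_pos h3', ← mul_assoc]
  calc _ ≤ min |z.re| ε⁻¹ * 3 := by gcongr
    _ = _ := mul_comm _ _

theorem tendsto_sin_mul_div (z : ℂ) :
    Tendsto (fun n : ℕ => (((n + 1 : ℝ)⁻¹ : ℝ) : ℂ)⁻¹ * Complex.sin (((n + 1 : ℝ)⁻¹ : ℝ) * z))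
      atTop (𝓝 z) := by
  have h1 : HasDerivAt (fun t : ℂ => Complex.sin (t * z)) z 0 := by
    have h := ((hasDerivAt_id (0 : ℂ)).mul_const z).csin
    simpa using h
  have h2 : Tendsto (fun n : ℕ => (((n + 1 : ℝ)⁻¹ : ℝ) : ℂ)) atTop (𝓝[≠] 0) := by
    refine tendsto_nhdsWithin_iff.2 ⟨?_, Eventually.of_forall fun n => ?_⟩
    · have := tendsto_one_div_add_atTop_nhds_zero_nat (𝕜 := ℂ)
      simpa using this
    · simp only [Set.mem_compl_iff, Set.mem_singleton_iff, Complex.ofReal_eq_zero]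
      positivity
  simpa [Function.comp_def] using h1.tendsto_slope_zero.comp h2

namespace ClosedSubalgebra

variable {H : ClosedSubalgebra μ} [IsProbabilityMeasure μ]

theorem MemFun.sin {h : S → ℂ} (hh : H.MemFun h) (hi : Integrable h μ) :
    H.MemFun (fun x => Complex.sin (h x)) := by
  have h1 := (hh.const_mul (-Complex.I)).exp (hi.const_mul _)
  have h2 := (hh.const_mul Complex.I).exp (hi.const_mul _)
  refine ((h1.sub h2).const_mul (Complex.I / 2)).congr (Eventually.of_forall fun x => ?_)
  simp only [Complex.sin]
  rw [show -Complex.I * h x = -h x * Complex.I by ring, mul_comm Complex.I (h x)]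
  ring

/-- If `h ∈ H₁` has a small imaginary part, then `ℛ` is bounded on `L₂(e^{Re h})` for functions
supported where `Re h` is bounded. -/
theorem sqInt_riesz_le_of_abs_im_le {h : S → ℂ} (hh : H.MemFun h) (hi : Integrable h μ)
    (him : ∀ᵐ x ∂μ, |(h x).im| ≤ 1 / 4) (f : Lp ℂ 2 μ) {N : ℝ}
    (hN : ∀ᵐ x ∂μ, f x ≠ 0 → |(h x).re| ≤ N) :
    sqInt (H.riesz f) (fun x => Real.exp (h x).re)
      ≤ ENNReal.ofReal ((7 / 8 : ℝ)⁻¹ ^ 2) * sqInt f (fun x => Real.exp (h x).re) := by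
  set ε : ℕ → ℝ := fun n => (n + 1 : ℝ)⁻¹ with hε
  have h0 : ∀ n, 0 < ε n := fun n => by positivity
  have h1 : ∀ n, ε n ≤ 1 := fun n => inv_le_one_of_one_le₀ (by simp)
  -- `exp (k n)` is a bounded element of `H` whose argument is at most 1/2, and its modulus tends to
  -- `e^{Re h}`.
  set k : ℕ → S → ℂ := fun n x => (ε n : ℂ)⁻¹ * Complex.sin (ε n * h x) with hk
  have hkH : ∀ n, H.MemFun (k n) := fun n =>
    (MemFun.sin (hh.const_mul _) (hi.const_mul _)).const_mul _
  have him1 : ∀ᵐ x ∂μ, |(h x).im| ≤ 1 := him.mono fun x hx => hx.trans (by norm_num)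
  have hkim : ∀ n, ∀ᵐ x ∂μ, |(k n x).im| ≤ 1 / 2 := fun n => by
    filter_upwards [him, him1] with x hx hx1
    exact (abs_im_sin_mul_div_le (h0 n) (h1 n) hx1).trans (by linarith)
  have hkre : ∀ n, ∀ᵐ x ∂μ, |(k n x).re| ≤ 3 * min |(h x).re| (ε n)⁻¹ := fun n => by
    filter_upwards [him1] with x hx1
    exact abs_re_sin_mul_div_le (h0 n) (h1 n) hx1
  have hkre' : ∀ n, ∀ᵐ x ∂μ, |(k n x).re| ≤ 3 * (ε n)⁻¹ := fun n =>
    (hkre n).mono fun x hx => hx.trans (by gcongr; exact min_le_right _ _)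
  have hki : ∀ n, Integrable (k n) μ := fun n => by
    refine Integrable.of_bound (hkH n).aestronglyMeasurable (3 * (ε n)⁻¹ + 1 / 2) ?_
    filter_upwards [hkre' n, hkim n] with x h2 h3
    exact (Complex.norm_le_abs_re_add_abs_im _).trans (by linarith)
  have hlim : ∀ x, Tendsto (fun n => ‖Complex.exp (k n x)‖) atTop (𝓝 (Real.exp (h x).re)) := by
    intro x
    have := ((Complex.continuous_exp.tendsto _).comp (tendsto_sin_mul_div (h x))).norm
    rw [Complex.norm_exp] at this
    exact this
  have hz : ∀ n, H.MemFun (fun x => Complex.exp (k n x)) := fun n => (hkH n).exp (hki n)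
  have hstep : ∀ n, sqInt (H.riesz f) (fun x => ‖Complex.exp (k n x)‖)
      ≤ ENNReal.ofReal ((7 / 8 : ℝ)⁻¹ ^ 2) * sqInt f (fun x => ‖Complex.exp (k n x)‖) := by
    intro n
    refine sqInt_riesz_le_of_sector (hz n) (B := Real.exp (3 * (ε n)⁻¹)) (by norm_num) ?_ ?_ f
    · filter_upwards [hkre' n] with x hx
      rw [Complex.norm_exp]
      exact Real.exp_le_exp.2 ((le_abs_self _).trans hx)
    · filter_upwards [hkim n] with x hx
      rw [Complex.norm_exp, Complex.exp_re, mul_comm]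
      -- The sector constant 7/8 is the bound `1 - (1/2)²/2` for the cosine.
      have h2 := Real.one_sub_sq_div_two_le_cos (x := (k n x).im)
      have h3 := sq_le_sq' (abs_le.1 hx).1 (abs_le.1 hx).2
      gcongr
      linarith
  -- The restriction on the support of `f` gives dominated convergence on this side only. Nothing is
  -- known about where `ℛ f` is large, so Fatou's lemma serves for it.
  have hR : Tendsto (fun n => sqInt f (fun x => ‖Complex.exp (k n x)‖)) atTop
      (𝓝 (sqInt f (fun x => Real.exp (h x).re))) := by
    refine tendsto_lintegral_of_dominated_convergence'
      (fun x => ‖f x‖ₑ ^ 2 * ENNReal.ofReal (Real.exp (3 * N))) (fun n => ?_) (fun n => ?_) ?_ ?_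
    · exact aemeasurable_enorm_sq_mul (Lp.aestronglyMeasurable _)
        (hz n).aestronglyMeasurable.norm.aemeasurable
    · filter_upwards [hkre n, hN] with x h2 h3
      by_cases hf : f x = 0
      · simp [hf]
      · rw [Complex.norm_exp]
        gcongr
        refine (le_abs_self _).trans (h2.trans ?_)
        gcongr
        exact (min_le_left _ _).trans (h3 hf)
    · rw [lintegral_mul_const' _ _ ENNReal.ofReal_ne_top]
      refine ENNReal.mul_ne_top ?_ ENNReal.ofReal_ne_top
      have := (Lp.memLp f).eLpNorm_lt_top
      rw [eLpNorm_lt_top_iff_lintegral_rpow_enorm_lt_top (by norm_num) (by norm_num)] at this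
      simpa using this.ne
    · refine Eventually.of_forall fun x => ?_
      exact ENNReal.Tendsto.const_mul (ENNReal.tendsto_ofReal (hlim x)) (Or.inr (by simp))
  refine (sqInt_le_liminf _ (fun n => (hz n).aestronglyMeasurable.norm.aemeasurable)
    (Eventually.of_forall hlim)).trans ?_
  rw [← (ENNReal.Tendsto.const_mul hR (Or.inr ENNReal.ofReal_ne_top)).liminf_eq]
  exact liminf_le_liminf (Eventually.of_forall hstep)

/-- `ℛ` is bounded on `L₂(e^w)` when `w` is uniformly close to an element of `H₁`. -/
theorem sqInt_riesz_le_of_norm_sub_le {h : S → ℂ} (hh : H.MemFun h) (hi : Integrable h μ)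
    {w : S → ℝ} (hw : AEMeasurable w μ) (hwh : ∀ᵐ x ∂μ, ‖(w x : ℂ) - h x‖ ≤ 1 / 4)
    (f : Lp ℂ 2 μ) :
    sqInt (H.riesz f) (fun x => Real.exp (w x))
      ≤ ENNReal.ofReal (Real.exp 1 ^ 2) * sqInt f (fun x => Real.exp (w x)) := by
  have hre : ∀ᵐ x ∂μ, |w x - (h x).re| ≤ 1 / 4 := by
    filter_upwards [hwh] with x hx
    simpa using (Complex.abs_re_le_norm _).trans hx
  have him : ∀ᵐ x ∂μ, |(h x).im| ≤ 1 / 4 := by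
    filter_upwards [hwh] with x hx
    simpa using (Complex.abs_im_le_norm _).trans hx
  have h1 : ∀ g : Lp ℂ 2 μ, sqInt g (fun x => Real.exp (w x))
      ≤ ENNReal.ofReal (Real.exp (1 / 4)) * sqInt g (fun x => Real.exp (h x).re) := fun g => by
    rw [← sqInt_const_mul _ (Real.exp_pos _).le]
    refine sqInt_mono ?_
    filter_upwards [hre] with x hx
    rw [← Real.exp_add]
    exact Real.exp_le_exp.2 (by linarith [(abs_le.1 hx).2])
  have h2 : ∀ g : Lp ℂ 2 μ, sqInt g (fun x => Real.exp (h x).re)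
      ≤ ENNReal.ofReal (Real.exp (1 / 4)) * sqInt g (fun x => Real.exp (w x)) := fun g => by
    rw [← sqInt_const_mul _ (Real.exp_pos _).le]
    refine sqInt_mono ?_
    filter_upwards [hre] with x hx
    rw [← Real.exp_add]
    exact Real.exp_le_exp.2 (by linarith [(abs_le.1 hx).1])
  obtain ⟨F, hF, hle, hsupp⟩ := exists_truncation f hw
  have hRF : Tendsto (fun n => H.riesz (F n)) atTop (𝓝 (H.riesz f)) :=
    (H.riesz.continuous.tendsto f).comp hF
  refine sqInt_le_of_tendsto hRF (Real.measurable_exp.comp_aemeasurable hw) fun n => ?_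
  have hN : ∀ᵐ x ∂μ, F n x ≠ 0 → |(h x).re| ≤ n + 1 / 4 := by
    filter_upwards [hre, hsupp n] with x h3 h4 h5
    have h6 := abs_sub_abs_le_abs_sub (h x).re (w x)
    rw [abs_sub_comm] at h6
    linarith [h4 h5]
  -- Passing from `w` to `Re h` and back costs `e^{1/4}` each time; the sector estimate costs
  -- `(8/7)² ≤ e^{1/2}`.
  have hconst : Real.exp (1 / 4) * ((7 / 8 : ℝ)⁻¹ ^ 2 * Real.exp (1 / 4)) ≤ Real.exp 1 ^ 2 := by
    have h3 : (7 / 8 : ℝ)⁻¹ ^ 2 ≤ Real.exp (1 / 2) :=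
      le_trans (by norm_num) (Real.add_one_le_exp (1 / 2 : ℝ))
    calc _ ≤ Real.exp (1 / 4) * (Real.exp (1 / 2) * Real.exp (1 / 4)) := by gcongr
      _ = Real.exp 1 := by rw [← Real.exp_add, ← Real.exp_add]; norm_num
      _ ≤ Real.exp 1 ^ 2 := by
          have := Real.one_le_exp (zero_le_one (α := ℝ)); nlinarith
  calc sqInt (H.riesz (F n)) (fun x => Real.exp (w x))
      ≤ ENNReal.ofReal (Real.exp (1 / 4)) * (ENNReal.ofReal ((7 / 8 : ℝ)⁻¹ ^ 2) *
        (ENNReal.ofReal (Real.exp (1 / 4)) * sqInt (F n) (fun x => Real.exp (w x)))) :=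
        (h1 _).trans (by
          gcongr
          exact (sqInt_riesz_le_of_abs_im_le hh hi him (F n) hN).trans (by gcongr; exact h2 _))
    _ = ENNReal.ofReal (Real.exp (1 / 4) * ((7 / 8 : ℝ)⁻¹ ^ 2 * Real.exp (1 / 4))) *
        sqInt (F n) (fun x => Real.exp (w x)) := by
        rw [ENNReal.ofReal_mul (by positivity), ENNReal.ofReal_mul (by positivity)]
        ring
    _ ≤ ENNReal.ofReal (Real.exp 1 ^ 2) * sqInt f (fun x => Real.exp (w x)) := by
        gcongr
        refine lintegral_mono_ae ?_
        filter_upwards [hle n] with x hx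
        gcongr
        exact enorm_le_iff_norm_le.2 hx

end ClosedSubalgebra

/-! ### From a weighted bound to a Hankel bound: angles, Nehari's theorem and logarithms. -/

/-- If the skew projection onto `ℂ p` along `ℂ q` has norm at most `√A`, then `p` and `q` form an
angle bounded away from `0`. -/
theorem norm_inner_le_of_forall_norm_sq_le {E : Type*} [NormedAddCommGroup E]
    [InnerProductSpace ℂ E] {p q : E} {A : ℝ} (hA : 1 ≤ A)
    (h : ∀ c : ℂ, ‖p‖ ^ 2 ≤ A * ‖p + c • q‖ ^ 2) :
    ‖inner ℂ p q‖ ≤ Real.sqrt (1 - A⁻¹) * (‖p‖ * ‖q‖) := by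
  set a : ℂ := inner ℂ p q with ha
  have hA0 : 0 < A := by linarith
  have hA1 : 0 ≤ 1 - A⁻¹ := sub_nonneg.2 (inv_le_one_of_one_le₀ hA)
  have h1 : ∀ t : ℝ, 0 ≤ (A * ‖a‖ ^ 2 * ‖q‖ ^ 2) * (t * t) + (2 * A * ‖a‖ ^ 2) * t
      + (A - 1) * ‖p‖ ^ 2 := by
    intro t
    -- With this phase the hypothesis becomes a nonnegative real quadratic in `t`; its discriminant
    -- gives `A |a|² ≤ (A - 1) ‖p‖² ‖q‖²`.
    have h2 := h (t * conj a)
    rw [norm_add_sq (𝕜 := ℂ), inner_smul_right, ← ha, mul_assoc, mul_comm (conj a) a,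
      Complex.mul_conj, Complex.normSq_eq_norm_sq, norm_smul, norm_mul] at h2
    simp only [RCLike.norm_conj, RCLike.re_to_complex, Complex.norm_real] at h2
    rw [← Complex.ofReal_mul, Complex.ofReal_re, mul_pow, mul_pow, Real.norm_eq_abs, sq_abs] at h2
    linarith
  have h2 := discrim_le_zero h1
  rw [discrim] at h2
  rcases (norm_nonneg a).eq_or_lt with h0 | h0
  · rw [← h0]; positivity
  · have h3 : ‖a‖ ^ 2 ≤ (1 - A⁻¹) * (‖p‖ * ‖q‖) ^ 2 := by
      have h4 : (4 * A * ‖a‖ ^ 2) * (A * ‖a‖ ^ 2 - (A - 1) * (‖p‖ * ‖q‖) ^ 2) ≤ 0 := by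
        linarith
      have h5 : A * ‖a‖ ^ 2 - (A - 1) * (‖p‖ * ‖q‖) ^ 2 ≤ 0 := by
        by_contra hc
        push Not at hc
        have : 0 < 4 * A * ‖a‖ ^ 2 := by positivity
        nlinarith
      have h6 : (1 - A⁻¹) * (‖p‖ * ‖q‖) ^ 2 = A⁻¹ * ((A - 1) * (‖p‖ * ‖q‖) ^ 2) := by
        field_simp
      rw [h6, le_inv_mul_iff₀ hA0]
      linarith
    refine (sq_le_sq₀ (norm_nonneg _) (by positivity)).1 (h3.trans (le_of_eq ?_))
    rw [mul_pow (Real.sqrt _), Real.sq_sqrt hA1]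

theorem norm_sq_eq_integral (f : Lp ℂ 2 μ) : ‖f‖ ^ 2 = ∫ x, ‖f x‖ ^ 2 ∂μ := by
  rw [← inner_self_eq_norm_sq (𝕜 := ℂ), L2.inner_def, ← integral_re (L2.integrable_inner f f)]
  exact integral_congr_ae (Eventually.of_forall fun x => inner_self_eq_norm_sq (𝕜 := ℂ) _)

theorem integrable_norm_sq (f : Lp ℂ 2 μ) : Integrable (fun x => ‖f x‖ ^ 2) μ :=
  (memLp_two_iff_integrable_sq_norm (Lp.aestronglyMeasurable f)).1 (Lp.memLp f)

theorem sqInt_eq_ofReal_norm_sq {f F : Lp ℂ 2 μ} {ω : S → ℝ}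
    (h : ∀ᵐ x ∂μ, ‖f x‖ ^ 2 * ω x = ‖F x‖ ^ 2) : sqInt f ω = ENNReal.ofReal (‖F‖ ^ 2) := by
  rw [norm_sq_eq_integral, ofReal_integral_eq_lintegral_ofReal (integrable_norm_sq F)
    (Eventually.of_forall fun x => by positivity)]
  refine lintegral_congr_ae ?_
  filter_upwards [h] with x hx
  rw [enorm_sq_mul_ofReal, hx]

/-- The inclusion of `L₂` into `L₁`. -/
def inclusionOne (μ : Measure S) [IsProbabilityMeasure μ] : Lp ℂ 2 μ →L[ℂ] Lp ℂ 1 μ :=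
  LinearMap.mkContinuous
    { toFun := fun f => ((Lp.memLp f).mono_exponent (p := 1) (by norm_num)).toLp f
      map_add' := fun f g => by
        rw [← MemLp.toLp_add]
        exact MemLp.toLp_congr _ _ (Lp.coeFn_add f g)
      map_smul' := fun c f => by
        rw [RingHom.id_apply, ← MemLp.toLp_const_smul]
        exact MemLp.toLp_congr _ _ (Lp.coeFn_smul c f) } 1 fun f => by
    simp only [LinearMap.coe_mk, AddHom.coe_mk, one_mul, Lp.norm_def]
    rw [eLpNorm_congr_ae (MemLp.coeFn_toLp _)]
    exact ENNReal.toReal_mono (Lp.eLpNorm_ne_top f)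
      (eLpNorm_le_eLpNorm_of_exponent_le (by norm_num) (Lp.aestronglyMeasurable f))

theorem coeFn_inclusionOne [IsProbabilityMeasure μ] (f : Lp ℂ 2 μ) :
    inclusionOne μ f =ᵐ[μ] f :=
  MemLp.coeFn_toLp ((Lp.memLp f).mono_exponent (p := 1) (by norm_num))

theorem norm_inclusionOne [IsProbabilityMeasure μ] (f : Lp ℂ 2 μ) :
    ‖inclusionOne μ f‖ = ∫ x, ‖f x‖ ∂μ := by
  rw [L1.norm_eq_integral_norm]
  refine integral_congr_ae ?_
  filter_upwards [coeFn_inclusionOne f] with x hx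
  rw [hx]

/-- A functional on a subspace of `L₂` which is bounded for the `L₁`-norm is represented by a
bounded function. -/
theorem exists_bounded_representative [IsProbabilityMeasure μ] (X : Submodule ℂ (Lp ℂ 2 μ))
    {u : S → ℂ} (hu : AEStronglyMeasurable u μ) (hu1 : ∀ᵐ x ∂μ, ‖u x‖ ≤ 1) {ρ : ℝ} (hρ : 0 ≤ ρ)
    (hX : ∀ k ∈ X, ‖∫ x, u x * k x ∂μ‖ ≤ ρ * ∫ x, ‖k x‖ ∂μ) :
    ∃ V : Lp ℂ 2 μ, (∀ᵐ x ∂μ, ‖V x‖ ≤ ρ) ∧ ∀ k ∈ X, inner ℂ V k = ∫ x, u x * k x ∂μ := by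
  have hint : ∀ f : Lp ℂ 1 μ, Integrable (fun x => u x * f x) μ := fun f =>
    (L1.integrable_coeFn f).bdd_mul hu hu1
  let L : Lp ℂ 1 μ →L[ℂ] ℂ := LinearMap.mkContinuous
    { toFun := fun f => ∫ x, u x * f x ∂μ
      map_add' := fun f g => by
        rw [← integral_add (hint f) (hint g)]
        refine integral_congr_ae ?_
        filter_upwards [Lp.coeFn_add f g] with x hx
        rw [hx, Pi.add_apply, mul_add]
      map_smul' := fun c f => by
        rw [RingHom.id_apply, smul_eq_mul, ← integral_const_mul]
        refine integral_congr_ae ?_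
        filter_upwards [Lp.coeFn_smul c f] with x hx
        rw [hx, Pi.smul_apply, smul_eq_mul]
        ring } 1 fun f => by
    rw [one_mul, L1.norm_eq_integral_norm]
    refine norm_integral_le_of_norm_le (L1.integrable_coeFn f).norm ?_
    filter_upwards [hu1] with x hx
    rw [norm_mul]
    exact mul_le_of_le_one_left (norm_nonneg _) hx
  have hL : ∀ f : Lp ℂ 2 μ, L (inclusionOne μ f) = ∫ x, u x * f x ∂μ := fun f => by
    refine integral_congr_ae ?_
    filter_upwards [coeFn_inclusionOne f] with x hx
    rw [hx]
  obtain ⟨Λ, hΛ, hΛn⟩ := exists_extension_norm_eq (X.map (inclusionOne μ).toLinearMap)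
    (L.comp (X.map (inclusionOne μ).toLinearMap).subtypeL)
  have hΛρ : ‖Λ‖ ≤ ρ := by
    rw [hΛn]
    refine ContinuousLinearMap.opNorm_le_bound _ hρ ?_
    rintro ⟨_, k, hk, rfl⟩
    change ‖L (inclusionOne μ k)‖ ≤ ρ * ‖inclusionOne μ k‖
    rw [hL, norm_inclusionOne]
    exact hX k hk
  -- The Hahn–Banach extension is represented through the Hilbert space `L₂`, and the bound on `V`
  -- is recovered by hand: testing on `V` restricted to `E = {|V| > ρ}` gives `∫_E |V|² ≤ ρ ∫_E
  -- |V|`, so `E` is null.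
  set V : Lp ℂ 2 μ := (InnerProductSpace.toDual ℂ _).symm (Λ.comp (inclusionOne μ)) with hVdef
  have hV : ∀ f, inner ℂ V f = Λ (inclusionOne μ f) := fun f => by
    rw [hVdef, InnerProductSpace.toDual_symm_apply]
    rfl
  refine ⟨V, ?_, fun k hk => ?_⟩
  · set E : Set S := {x | ρ < ‖V x‖} with hE
    have hEm : MeasurableSet E :=
      measurableSet_lt measurable_const (Lp.stronglyMeasurable V).norm.measurable
    have hfm : MemLp (E.indicator V) 2 μ := (Lp.memLp V).indicator hEm
    have h1 : ‖inner ℂ V (hfm.toLp _)‖ ≤ ρ * ∫ x, ‖E.indicator V x‖ ∂μ := by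
      rw [hV]
      refine (Λ.le_of_opNorm_le hΛρ _).trans (le_of_eq ?_)
      rw [norm_inclusionOne]
      congr 1
      refine integral_congr_ae ?_
      filter_upwards [hfm.coeFn_toLp] with x hx
      rw [hx]
    have h2 : inner ℂ V (hfm.toLp _) = ((∫ x, ‖E.indicator V x‖ ^ 2 ∂μ : ℝ) : ℂ) := by
      rw [L2.inner_def, ← integral_complex_ofReal]
      refine integral_congr_ae ?_
      filter_upwards [hfm.coeFn_toLp] with x hx
      rw [hx, RCLike.inner_apply]
      by_cases h : x ∈ E
      · simp only [Set.indicator_of_mem h]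
        rw [Complex.mul_conj, Complex.normSq_eq_norm_sq]
      · simp [h]
    rw [h2, Complex.norm_real, Real.norm_of_nonneg (integral_nonneg fun x => by positivity),
      ← integral_const_mul] at h1
    have hi1 : Integrable (fun x => ‖E.indicator V x‖ ^ 2) μ :=
      (memLp_two_iff_integrable_sq_norm hfm.1).1 hfm
    have hi2 : Integrable (fun x => ρ * ‖E.indicator V x‖) μ :=
      (hfm.integrable (by norm_num)).norm.const_mul _
    have h3 : ∀ x, 0 ≤ ‖E.indicator V x‖ ^ 2 - ρ * ‖E.indicator V x‖ := fun x => by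
      by_cases h : x ∈ E
      · simp only [Set.indicator_of_mem h]
        have : ρ < ‖V x‖ := h
        nlinarith
      · simp [h]
    have h4 : ∫ x, (‖E.indicator V x‖ ^ 2 - ρ * ‖E.indicator V x‖) ∂μ = 0 := by
      refine le_antisymm ?_ (integral_nonneg h3)
      rw [integral_sub hi1 hi2]
      linarith
    rw [integral_eq_zero_iff_of_nonneg h3 (hi1.sub hi2)] at h4
    filter_upwards [h4] with x hx
    by_contra hc
    have h : x ∈ E := not_le.1 hc
    have h' : ρ < ‖V x‖ := h
    simp only [Set.indicator_of_mem h, Pi.zero_apply] at hx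
    nlinarith
  · rw [hV, ← hL]
    exact hΛ ⟨_, k, hk, rfl⟩

namespace ClosedSubalgebra

variable {H : ClosedSubalgebra μ}

/-- In an algebra of Dirichlet type, each `φ ∈ L₂` which is bounded below by a positive constant
is the modulus of a unit of `H`. -/
theorem IsDirichletType.exists_unit [IsProbabilityMeasure μ] (hD : H.IsDirichletType)
    {φ : S → ℝ} (hφ : MemLp φ 2 μ) {m : ℝ} (hm : 0 < m) (hmφ : ∀ᵐ x ∂μ, m ≤ φ x) :
    ∃ g g' : S → ℂ, H.MemFun g ∧ H.MemFun g' ∧ (∀ᵐ x ∂μ, g x * g' x = 1) ∧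
      ∀ᵐ x ∂μ, ‖g x‖ = φ x := by
  have h1 : AEStronglyMeasurable (fun x => (φ x : ℂ)) μ :=
    Complex.continuous_ofReal.comp_aestronglyMeasurable hφ.1
  have h2 : AEStronglyMeasurable (fun x => ((φ x)⁻¹ : ℂ)) μ :=
    (Complex.measurable_ofReal.comp_aemeasurable hφ.1.aemeasurable).inv.aestronglyMeasurable
  have hl1 : MemLlog (AEEqFun.mk _ h1) := by
    have hi : Integrable φ μ := hφ.integrable (by norm_num)
    refine lt_of_le_of_lt (lintegral_mono_ae ?_) hi.2
    filter_upwards [AEEqFun.coeFn_mk _ h1] with x h3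
    rw [h3, Complex.norm_real, ← ofReal_norm]
    exact ENNReal.ofReal_le_ofReal (posLog_le_self (norm_nonneg _))
  have hl2 : MemLlog (AEEqFun.mk _ h2) := by
    refine lt_of_le_of_lt (lintegral_mono_ae (g := fun _ => ENNReal.ofReal m⁻¹) ?_) (by simp)
    filter_upwards [AEEqFun.coeFn_mk _ h2, hmφ] with x h3 h4
    refine ENNReal.ofReal_le_ofReal ((posLog_le_self (norm_nonneg _)).trans ?_)
    rw [h3, norm_inv, Complex.norm_real, Real.norm_of_nonneg (hm.le.trans h4)]
    exact inv_anti₀ hm h4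
  have hmul : AEEqFun.mk _ h1 * AEEqFun.mk _ h2 = 1 := by
    rw [AEEqFun.mk_mul_mk, AEEqFun.one_def]
    refine AEEqFun.mk_eq_mk.2 ?_
    filter_upwards [hmφ] with x h3
    have : (φ x : ℂ) ≠ 0 := by exact_mod_cast (hm.trans_le h3).ne'
    simp [this]
  obtain ⟨G, hG, G', hG', hGG, hGn⟩ := hD _ _ hl1 hl2 hmul
  refine ⟨G, G', memFun_coe.2 hG, memFun_coe.2 hG', ?_, ?_⟩
  · filter_upwards [AEEqFun.coeFn_mul G G', AEEqFun.coeFn_one (α := S) (β := ℂ) (μ := μ)]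
      with x h3 h4
    rw [hGG, h4] at h3
    exact h3.symm
  · filter_upwards [hGn, AEEqFun.coeFn_mk _ h1, hmφ] with x h3 h4 h5
    rw [h3, h4, Complex.norm_real, Real.norm_of_nonneg (hm.le.trans h5)]

/-- Multiplication by `conj φ` is adjoint to multiplication by `φ`, which preserves `H₂`. -/
theorem conj_mul_mem_orthogonal {φ : S → ℂ} (hφ : H.MemFun φ) {B : ℝ}
    (hB : ∀ᵐ x ∂μ, ‖φ x‖ ≤ B) {k : Lp ℂ 2 μ} (hk : k ∈ H.hardyTwoᗮ)
    (h2 : MemLp (fun x => conj (φ x) * k x) 2 μ) : h2.toLp _ ∈ H.hardyTwoᗮ := by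
  rw [Submodule.mem_orthogonal] at hk ⊢
  intro q hq
  have hm : MemLp (fun x => φ x * q x) 2 μ :=
    memLp_bdd_mul hφ.aestronglyMeasurable hB (Lp.memLp q)
  rw [← hk _ ((hφ.mul (mem_hardyTwo.1 hq)).toLp_mem hm), L2.inner_def, L2.inner_def]
  refine integral_congr_ae ?_
  filter_upwards [h2.coeFn_toLp, hm.coeFn_toLp] with x h3 h4
  rw [h3, h4, RCLike.inner_apply, RCLike.inner_apply, map_mul]
  ring

variable [IsProbabilityMeasure μ]

/-- Factorization: bounds of a Hankel form on `H₂ × H₂ᗮ` pass to the `L₁`-norm. -/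
theorem norm_integral_mul_le_of_hankel (hD : H.IsDirichletType) {u : S → ℂ} {ρ : ℝ} (hρ : 0 ≤ ρ)
    (hb : ∀ P ∈ H.hardyTwo, ∀ K ∈ H.hardyTwoᗮ,
      ‖∫ x, conj (P x) * (u x * K x) ∂μ‖ ≤ ρ * (‖P‖ * ‖K‖))
    {k : Lp ℂ 2 μ} (hk : k ∈ H.hardyTwoᗮ) :
    ‖∫ x, u x * k x ∂μ‖ ≤ ρ * ∫ x, ‖k x‖ ∂μ := by
  set I := ∫ x, ‖k x‖ ∂μ with hI
  have hI0 : 0 ≤ I := integral_nonneg fun x => norm_nonneg _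
  have hki : Integrable (fun x => ‖k x‖) μ := ((Lp.memLp k).integrable (by norm_num)).norm
  have key : ∀ ε : ℝ, 0 < ε → ‖∫ x, u x * k x ∂μ‖ ≤ ρ * (I + ε) := by
    intro ε hε
    have hφm : AEStronglyMeasurable (fun x => Real.sqrt (‖k x‖ + ε)) μ :=
      Real.continuous_sqrt.comp_aestronglyMeasurable (hki.1.add aestronglyMeasurable_const)
    have hsq : ∀ x, Real.sqrt (‖k x‖ + ε) ^ 2 = ‖k x‖ + ε := fun x =>
      Real.sq_sqrt (by positivity)
    have hφ : MemLp (fun x => Real.sqrt (‖k x‖ + ε)) 2 μ := by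
      rw [memLp_two_iff_integrable_sq hφm]
      simp only [hsq]
      exact hki.add (integrable_const ε)
    -- With `|s|² = |k| + ε`, the factors `s ∈ H₂` and `conj s' · k ∈ H₂ᗮ` both have squared norm at
    -- most `I + ε`, and the Hankel form on this pair is `∫ u k`. The shift by `ε` keeps `s'`
    -- bounded.
    obtain ⟨s, s', hs, hs', hss, hsn⟩ := hD.exists_unit hφ (Real.sqrt_pos.2 hε)
      (Eventually.of_forall fun x => Real.sqrt_le_sqrt (by linarith [norm_nonneg (k x)]))
    have hs2 : MemLp s 2 μ := by
      refine hφ.of_le hs.aestronglyMeasurable ?_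
      filter_upwards [hsn] with x hx
      rw [hx]; exact le_abs_self _
    have hs'n : ∀ᵐ x ∂μ, ‖s' x‖ ^ 2 * (‖k x‖ + ε) = 1 := by
      filter_upwards [hss, hsn] with x h1 h2
      rw [← hsq, ← h2, ← mul_pow, mul_comm, ← norm_mul, h1]; simp
    have hs'B : ∀ᵐ x ∂μ, ‖s' x‖ ≤ Real.sqrt ε⁻¹ := by
      filter_upwards [hs'n] with x hx
      refine Real.le_sqrt_of_sq_le ?_
      rw [← one_div, le_div_iff₀ hε]
      nlinarith [norm_nonneg (k x), sq_nonneg ‖s' x‖]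
    have hK2 : MemLp (fun x => conj (s' x) * k x) 2 μ :=
      memLp_bdd_mul (Complex.continuous_conj.comp_aestronglyMeasurable hs'.aestronglyMeasurable)
        (B := Real.sqrt ε⁻¹) (by simpa using hs'B) (Lp.memLp k)
    have h1 := hb _ (hs.toLp_mem hs2) _ (conj_mul_mem_orthogonal hs' hs'B hk hK2)
    have h2 : ∫ x, conj (hs2.toLp s x) * (u x * hK2.toLp _ x) ∂μ = ∫ x, u x * k x ∂μ := by
      refine integral_congr_ae ?_
      filter_upwards [hs2.coeFn_toLp, hK2.coeFn_toLp, hss] with x h3 h4 h5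
      rw [h3, h4]
      calc conj (s x) * (u x * (conj (s' x) * k x)) = conj (s x * s' x) * (u x * k x) := by
            rw [map_mul]; ring
        _ = u x * k x := by rw [h5]; simp
    have h3 : ‖hs2.toLp s‖ ^ 2 = I + ε := by
      have e : ∫ x, (‖k x‖ + ε) ∂μ = I + ε := by
        rw [integral_add hki (integrable_const ε)]; simp [hI]
      rw [norm_sq_eq_integral, ← e]
      refine integral_congr_ae ?_
      filter_upwards [hs2.coeFn_toLp, hsn] with x h3 h4
      rw [h3, h4, hsq]
    have h4 : ‖hK2.toLp _‖ ^ 2 ≤ I + ε := by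
      refine le_trans ?_ (le_add_of_nonneg_right hε.le)
      rw [norm_sq_eq_integral]
      refine integral_mono_ae (integrable_norm_sq _) hki ?_
      filter_upwards [hK2.coeFn_toLp, hs'n] with x h4 h5
      rw [h4, norm_mul, RCLike.norm_conj, mul_pow]
      have h6 : ‖s' x‖ ^ 2 * ‖k x‖ ≤ 1 := by nlinarith [sq_nonneg ‖s' x‖]
      nlinarith [norm_nonneg (k x)]
    rw [h2] at h1
    refine h1.trans (mul_le_mul_of_nonneg_left ?_ hρ)
    nlinarith [sq_nonneg (‖hs2.toLp s‖ - ‖hK2.toLp _‖)]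
  refine le_of_forall_pos_le_add fun δ hδ => ?_
  refine (key (δ / (ρ + 1)) (by positivity)).trans ?_
  rw [mul_add]
  gcongr
  rw [mul_div_assoc', div_le_iff₀ (by positivity)]
  nlinarith

/-- Nehari's theorem for `H`. -/
theorem exists_memFun_norm_sub_conj_le (hD : H.IsDirichletType) {u : S → ℂ}
    (hu : AEStronglyMeasurable u μ) (hu1 : ∀ᵐ x ∂μ, ‖u x‖ ≤ 1) {ρ : ℝ} (hρ : 0 ≤ ρ)
    (hb : ∀ P ∈ H.hardyTwo, ∀ K ∈ H.hardyTwoᗮ,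
      ‖∫ x, conj (P x) * (u x * K x) ∂μ‖ ≤ ρ * (‖P‖ * ‖K‖)) :
    ∃ G : S → ℂ, H.MemFun G ∧ ∀ᵐ x ∂μ, ‖G x - conj (u x)‖ ≤ ρ := by
  obtain ⟨V, hVρ, hV⟩ := exists_bounded_representative H.hardyTwoᗮ hu hu1 hρ
    fun k hk => norm_integral_mul_le_of_hankel hD hρ hb hk
  have hW2 : MemLp (fun x => conj (u x)) 2 μ :=
    MemLp.of_bound (Complex.continuous_conj.comp_aestronglyMeasurable hu) 1 (by simpa using hu1)
  -- `V` and `conj u` induce the same functional on `H₂ᗮ`, so their difference lies in the double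
  -- complement, which is the closed space `H₂`.
  have hmem : hW2.toLp _ - V ∈ H.hardyTwo := by
    rw [← Submodule.orthogonal_orthogonal H.hardyTwo, Submodule.mem_orthogonal']
    intro k hk
    rw [inner_sub_left, hV k hk, sub_eq_zero, L2.inner_def]
    refine integral_congr_ae ?_
    filter_upwards [hW2.coeFn_toLp] with x hx
    rw [hx, RCLike.inner_apply, RCLike.conj_conj, mul_comm]
  refine ⟨_, mem_hardyTwo.1 hmem, ?_⟩
  filter_upwards [hVρ, Lp.coeFn_sub (hW2.toLp _) V, hW2.coeFn_toLp] with x h1 h2 h3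
  rw [h2, Pi.sub_apply, h3]
  simpa using h1

/-- The distance from the logarithm of a weight `ω` to `H₁` which is obtained when the squared norm
of `ℛ` on `L₂(ω)` is at most `A`. -/
def logDist (A : ℝ) : ℝ :=
  Real.sqrt (1 - A⁻¹) ^ 2 * (1 - Real.sqrt (1 - A⁻¹))⁻¹ / 2 + Real.sqrt (1 - A⁻¹)

theorem norm_log_le_logDist {A : ℝ} (hA : 1 ≤ A) {ζ : ℂ} (h : ‖ζ - 1‖ ≤ Real.sqrt (1 - A⁻¹)) :
    ‖Complex.log ζ‖ ≤ logDist A := by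
  have h1 : Real.sqrt (1 - A⁻¹) < 1 := by
    rw [Real.sqrt_lt' one_pos]
    have : 0 < A⁻¹ := by positivity
    linarith
  have h2 := Complex.norm_log_one_add_le (h.trans_lt h1)
  rw [add_sub_cancel] at h2
  refine h2.trans ?_
  rw [logDist]
  have h3 : 0 < 1 - Real.sqrt (1 - A⁻¹) := by linarith
  have h4 : 0 ≤ 1 - ‖ζ - 1‖ := by linarith
  gcongr

theorem logDist_nonneg {A : ℝ} (hA : 1 ≤ A) : 0 ≤ logDist A :=
  (norm_nonneg _).trans (norm_log_le_logDist hA (ζ := 1) (by simp))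

/-- Put `p = g' P ∈ H₂` and `k = conj g' · K ∈ H₂ᗮ`. Then `ℛ (p + c k) = p`, while multiplication by
`g` carries `L₂(ω)` isometrically to `L₂`, sending `p` to `P` and `k` to `u K` with `u = g conj g'`.
The bound on `ℛ` is thus the angle condition between `P` and `u K`. -/
theorem norm_integral_le_of_sqInt_riesz_le {ω : S → ℝ} {A : ℝ} (hA : 1 ≤ A)
    (hR : ∀ f : Lp ℂ 2 μ, sqInt (H.riesz f) ω ≤ ENNReal.ofReal A * sqInt f ω)
    {g g' : S → ℂ} (hg' : H.MemFun g') {B : ℝ} (hB : ∀ᵐ x ∂μ, ‖g' x‖ ≤ B)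
    (hgm : AEStronglyMeasurable g μ)
    (hgg : ∀ᵐ x ∂μ, g x * g' x = 1) (hgω : ∀ᵐ x ∂μ, ‖g x‖ ^ 2 = ω x)
    {P K : Lp ℂ 2 μ} (hP : P ∈ H.hardyTwo) (hK : K ∈ H.hardyTwoᗮ) :
    ‖∫ x, conj (P x) * (g x * conj (g' x) * K x) ∂μ‖ ≤ Real.sqrt (1 - A⁻¹) * (‖P‖ * ‖K‖) := by
  have hA0 : 0 < A := by linarith
  have hun : ∀ᵐ x ∂μ, ‖g x * conj (g' x)‖ = 1 := by
    filter_upwards [hgg] with x hx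
    rw [norm_mul, RCLike.norm_conj, ← norm_mul, hx, norm_one]
  have hcg' := Complex.continuous_conj.comp_aestronglyMeasurable hg'.aestronglyMeasurable
  have hQ2 : MemLp (fun x => g x * conj (g' x) * K x) 2 μ :=
    memLp_bdd_mul (hgm.mul hcg') (hun.mono fun x hx => hx.le) (Lp.memLp K)
  have hp2 : MemLp (fun x => g' x * P x) 2 μ :=
    memLp_bdd_mul hg'.aestronglyMeasurable hB (Lp.memLp P)
  have hk2 : MemLp (fun x => conj (g' x) * K x) 2 μ :=
    memLp_bdd_mul hcg' (B := B) (by simpa using hB) (Lp.memLp K)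
  have hpH := (hg'.mul (mem_hardyTwo.1 hP)).toLp_mem hp2
  have hkH := conj_mul_mem_orthogonal hg' hB hK hk2
  have h1 : ∀ c : ℂ, ‖P‖ ^ 2 ≤ A * ‖P + c • hQ2.toLp _‖ ^ 2 := by
    intro c
    have h2 : H.riesz (hp2.toLp _ + c • hk2.toLp _) = hp2.toLp _ := by
      rw [riesz, map_add, map_smul, Submodule.starProjection_eq_self_iff.2 hpH,
        (Submodule.starProjection_apply_eq_zero_iff _).2 hkH, smul_zero, add_zero]
    have h3 := hR (hp2.toLp _ + c • hk2.toLp _)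
    rw [h2, sqInt_eq_ofReal_norm_sq (F := P),
      sqInt_eq_ofReal_norm_sq (F := P + c • hQ2.toLp _), ← ENNReal.ofReal_mul hA0.le] at h3
    · exact (ENNReal.ofReal_le_ofReal_iff (by positivity)).1 h3
    · filter_upwards [Lp.coeFn_add (hp2.toLp _) (c • hk2.toLp _), Lp.coeFn_smul c (hk2.toLp _),
        Lp.coeFn_add P (c • hQ2.toLp _), Lp.coeFn_smul c (hQ2.toLp _), hp2.coeFn_toLp,
        hk2.coeFn_toLp, hQ2.coeFn_toLp, hgg, hgω] with x e1 e2 e3 e4 e5 e6 e7 e8 e9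
      rw [e1, e3, Pi.add_apply, Pi.add_apply, e2, e4, Pi.smul_apply, Pi.smul_apply, e5, e6, e7,
        ← e9, ← mul_pow, ← norm_mul, smul_eq_mul, smul_eq_mul]
      congr 2
      linear_combination P x * e8
    · filter_upwards [hp2.coeFn_toLp, hgg, hgω] with x e1 e2 e3
      rw [e1, ← e3, ← mul_pow, ← norm_mul]
      congr 2
      linear_combination P x * e2
  have h4 := norm_inner_le_of_forall_norm_sq_le hA h1
  have h5 : ‖hQ2.toLp _‖ = ‖K‖ := by
    rw [← sq_eq_sq₀ (norm_nonneg _) (norm_nonneg _), norm_sq_eq_integral, norm_sq_eq_integral]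
    refine integral_congr_ae ?_
    filter_upwards [hQ2.coeFn_toLp, hun] with x e1 e2
    rw [e1, norm_mul, e2, one_mul]
  rw [h5, L2.inner_def] at h4
  convert h4 using 2
  refine integral_congr_ae ?_
  filter_upwards [hQ2.coeFn_toLp] with x e1
  rw [e1, RCLike.inner_apply, mul_comm]

/-- If `ℛ` is bounded on `L₂(ω)`, where `ω` is bounded above and below, then `log ω` is
uniformly close to a bounded element of `H`. -/
theorem exists_memFun_near_log (hD : H.IsDirichletType) {ω : S → ℝ} (hω : AEMeasurable ω μ)
    {m B A : ℝ} (hm : 0 < m) (hmω : ∀ᵐ x ∂μ, m ≤ ω x) (hωB : ∀ᵐ x ∂μ, ω x ≤ B) (hA : 1 ≤ A)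
    (hR : ∀ f : Lp ℂ 2 μ, sqInt (H.riesz f) ω ≤ ENNReal.ofReal A * sqInt f ω) :
    ∃ h : S → ℂ, H.MemFun h ∧ ∀ᵐ x ∂μ, ‖(Real.log (ω x) : ℂ) - h x‖ ≤ logDist A := by
  set ρ := Real.sqrt (1 - A⁻¹) with hρdef
  have hρ0 : 0 ≤ ρ := Real.sqrt_nonneg _
  have hρ1 : ρ < 1 := by
    rw [hρdef, Real.sqrt_lt' one_pos]
    have : 0 < A⁻¹ := by positivity
    linarith
  have hφm : AEStronglyMeasurable (fun x => Real.sqrt (ω x)) μ :=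
    Real.continuous_sqrt.comp_aestronglyMeasurable hω.aestronglyMeasurable
  have hφ : MemLp (fun x => Real.sqrt (ω x)) 2 μ := by
    refine MemLp.of_bound hφm (Real.sqrt B) ?_
    filter_upwards [hωB] with x hx
    rw [Real.norm_of_nonneg (Real.sqrt_nonneg _)]
    exact Real.sqrt_le_sqrt hx
  obtain ⟨g, g', hg, hg', hgg, hgn⟩ := hD.exists_unit hφ (Real.sqrt_pos.2 hm)
    (hmω.mono fun x hx => Real.sqrt_le_sqrt hx)
  have hgω : ∀ᵐ x ∂μ, ‖g x‖ ^ 2 = ω x := by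
    filter_upwards [hgn, hmω] with x h1 h2
    rw [h1, Real.sq_sqrt (hm.le.trans h2)]
  have hg'B : ∀ᵐ x ∂μ, ‖g' x‖ ≤ (Real.sqrt m)⁻¹ := by
    filter_upwards [hgg, hgn, hmω] with x h1 h2 h3
    have h4 : 0 < Real.sqrt m := Real.sqrt_pos.2 hm
    have h5 := congrArg norm h1
    rw [norm_mul, norm_one, h2] at h5
    rw [← one_div, le_div_iff₀ h4]
    have := Real.sqrt_le_sqrt h3
    nlinarith [norm_nonneg (g' x)]
  have hu : AEStronglyMeasurable (fun x => g x * conj (g' x)) μ := hg.aestronglyMeasurable.mul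
    (Complex.continuous_conj.comp_aestronglyMeasurable hg'.aestronglyMeasurable)
  have hun : ∀ᵐ x ∂μ, ‖g x * conj (g' x)‖ = 1 := by
    filter_upwards [hgg] with x hx
    rw [norm_mul, RCLike.norm_conj, ← norm_mul, hx, norm_one]
  obtain ⟨G, hG, hGu⟩ := exists_memFun_norm_sub_conj_le hD hu (hun.mono fun x hx => hx.le) hρ0
    fun P hP K hK => norm_integral_le_of_sqInt_riesz_le hA hR hg' hg'B hg.aestronglyMeasurable
      hgg hgω hP hK
  -- Here `ζ = u G`: since `ω = g conj g` and `g g' = 1`, one has `g² = ω u`, and `|u G - 1| = |G -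
  -- conj u|` because `u` is unimodular.
  have hz : ∀ᵐ x ∂μ, ∃ ζ : ℂ, g x * g x * G x = ω x * ζ ∧ ‖ζ - 1‖ ≤ ρ := by
    filter_upwards [hGu, hgg, hgω, hun] with x h1 h2 h3 h4
    refine ⟨g x * conj (g' x) * G x, ?_, ?_⟩
    · have e1 : (ω x : ℂ) = g x * conj (g x) := by
        rw [Complex.mul_conj, Complex.normSq_eq_norm_sq, h3]
      have e2 : conj (g x) * conj (g' x) = 1 := by rw [← map_mul, h2, map_one]
      rw [e1]
      linear_combination -(g x * g x * G x) * e2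
    · have e1 : g x * conj (g' x) * conj (g x * conj (g' x)) = 1 := by
        rw [Complex.mul_conj, Complex.normSq_eq_norm_sq, h4]; simp
      calc ‖g x * conj (g' x) * G x - 1‖
          = ‖g x * conj (g' x) * (G x - conj (g x * conj (g' x)))‖ := by rw [mul_sub, e1]
        _ ≤ ρ := by rw [norm_mul, h4, one_mul]; exact h1
  refine ⟨fun x => Complex.log (g x * g x * G x), ((hg.mul hg).mul hG).log
    (B := B * (1 + ρ)) (δ := m * (1 - ρ)) (mul_pos hm (by linarith)) ?_ ?_, ?_⟩
  · filter_upwards [hz, hmω, hωB] with x ⟨ζ, h1, h2⟩ h3 h4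
    have h5 : ‖ζ‖ ≤ 1 + ρ := by
      calc ‖ζ‖ = ‖1 + (ζ - 1)‖ := by rw [add_sub_cancel]
        _ ≤ 1 + ρ := (norm_add_le _ _).trans (by rw [norm_one]; linarith)
    rw [h1, norm_mul, Complex.norm_real, Real.norm_of_nonneg (hm.le.trans h3)]
    have := hm.le.trans h3
    gcongr
    linarith
  · filter_upwards [hz, hmω] with x ⟨ζ, h1, h2⟩ h3
    have h4 := (abs_le.1 ((Complex.abs_re_le_norm _).trans h2)).1
    rw [Complex.sub_re, Complex.one_re] at h4
    rw [h1, Complex.re_ofReal_mul]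
    have := hm.le.trans h3
    have h5 : 1 - ρ ≤ ζ.re := by linarith
    have h6 : 0 ≤ 1 - ρ := by linarith
    gcongr
  · filter_upwards [hz, hmω] with x ⟨ζ, h1, h2⟩ h3
    have hζ : ζ ≠ 0 := by
      rintro rfl
      rw [zero_sub, norm_neg, norm_one] at h2
      linarith
    rw [h1, Complex.log_ofReal_mul (hm.trans_le h3) hζ, sub_add_cancel_left, norm_neg]
    exact norm_log_le_logDist hA h2

end ClosedSubalgebra

/-! ### Compactness: the uniform distance to `H₁` under `L₁` limits. -/

/-- Bounded decreasing convex sets in a Hilbert space have a common point of closure. -/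
theorem exists_forall_mem_closure_of_antitone {E : Type*} [NormedAddCommGroup E]
    [InnerProductSpace ℝ E] [CompleteSpace E] {T : ℕ → Set E} (hT : Antitone T)
    (hne : ∀ n, (T n).Nonempty) (hc : ∀ n, Convex ℝ (T n)) {r : ℝ}
    (hr : ∀ n, ∀ y ∈ T n, ‖y‖ ≤ r) : ∃ b, ∀ n, b ∈ closure (T n) := by
  have h1 : ∀ n, ∃ v ∈ closure (T n), ∀ y ∈ closure (T n), ‖v‖ ≤ ‖y‖ := fun n => by
    obtain ⟨v, hv, hvn⟩ := exists_norm_eq_iInf_of_complete_convex (hne n).closure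
      isClosed_closure.isComplete (hc n).closure 0
    refine ⟨v, hv, fun y hy => ?_⟩
    rw [zero_sub, norm_neg] at hvn
    rw [hvn]
    refine (ciInf_le ⟨0, ?_⟩ (⟨y, hy⟩ : closure (T n))).trans (by simp)
    rintro _ ⟨z, rfl⟩
    positivity
  choose x hx hmin using h1
  have hanti : ∀ n m, n ≤ m → closure (T m) ⊆ closure (T n) := fun n m h => closure_mono (hT h)
  have hle : ∀ n m, n ≤ m → ‖x n‖ ≤ ‖x m‖ := fun n m h => hmin n _ (hanti n m h (hx m))
  -- `x n` is the point of least norm in the closure of `T n`. The midpoint of `x n` and `x m` is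
  -- still in the closure of `T n`, so the parallelogram law bounds their distance by the increase
  -- of the bounded monotone sequence `‖x n‖²`.
  have hdist : ∀ n m, n ≤ m → ‖x n - x m‖ ^ 2 ≤ 2 * (‖x m‖ ^ 2 - ‖x n‖ ^ 2) := by
    intro n m h
    have h2 : (1 / 2 : ℝ) • x n + (1 / 2 : ℝ) • x m ∈ closure (T n) :=
      (hc n).closure (hx n) (hanti n m h (hx m)) (by norm_num) (by norm_num) (by norm_num)
    have h3 := hmin n _ h2
    rw [← smul_add, norm_smul, Real.norm_of_nonneg (by norm_num)] at h3
    have h4 := parallelogram_law_with_norm ℝ (x n) (x m)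
    nlinarith [norm_nonneg (x n), norm_nonneg (x n + x m)]
  obtain ⟨a, ha⟩ : ∃ a, Tendsto (fun n => ‖x n‖ ^ 2) atTop (𝓝 a) := by
    refine ⟨_, tendsto_atTop_ciSup (fun n m h => ?_) ⟨r ^ 2, ?_⟩⟩
    · have := hle n m h
      gcongr
    · rintro _ ⟨n, rfl⟩
      obtain ⟨y, hy⟩ := hne n
      have := (hmin n y (subset_closure hy)).trans (hr n y hy)
      dsimp only
      gcongr
  have hmono : Monotone fun n => ‖x n‖ ^ 2 := fun n m h => by
    have := hle n m h
    dsimp only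
    gcongr
  have hcs : CauchySeq x := by
    refine cauchySeq_of_le_tendsto_0' (fun n => Real.sqrt (2 * (a - ‖x n‖ ^ 2))) (fun n m h => ?_) ?_
    · rw [dist_eq_norm]
      refine Real.le_sqrt_of_sq_le ((hdist n m h).trans ?_)
      have := hmono.ge_of_tendsto ha m
      linarith
    · have := (Real.continuous_sqrt.tendsto _).comp (((tendsto_const_nhds (x := a)).sub ha).const_mul 2)
      simpa [Function.comp_def] using this
  obtain ⟨b, hb⟩ := cauchySeq_tendsto_of_complete hcs
  refine ⟨b, fun n => isClosed_closure.mem_of_tendsto hb ?_⟩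
  filter_upwards [eventually_ge_atTop n] with m hm
  exact hanti n m hm (hx m)

namespace ClosedSubalgebra

variable {H : ClosedSubalgebra μ}

/-- `H₁` is closed in `L₁`. -/
theorem memFun_of_tendsto_eLpNorm_one {f : ℕ → S → ℂ} {g : S → ℂ} (hf : ∀ n, H.MemFun (f n))
    (hg : Integrable g μ) (hlim : Tendsto (fun n => eLpNorm (f n - g) 1 μ) atTop (𝓝 0)) :
    H.MemFun g := by
  refine ⟨AEEqFun.mk g hg.1, ?_, AEEqFun.coeFn_mk g hg.1⟩
  refine H.closed _ ?_ fun ε hε => ?_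
  · refine lt_of_le_of_lt (lintegral_mono_ae ?_) hg.2
    filter_upwards [AEEqFun.coeFn_mk g hg.1] with x hx
    rw [hx, ← ofReal_norm]
    exact ENNReal.ofReal_le_ofReal (posLog_le_self (norm_nonneg _))
  · obtain ⟨n, hn⟩ := (hlim.eventually (gt_mem_nhds hε)).exists
    obtain ⟨G, hG, hGf⟩ := hf n
    refine ⟨G, hG, lt_of_le_of_lt ?_ hn⟩
    rw [eLpNorm_one_eq_lintegral_enorm]
    refine lintegral_mono_ae ?_
    filter_upwards [AEEqFun.coeFn_mk g hg.1, hGf, AEEqFun.coeFn_sub (AEEqFun.mk g hg.1) G]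
      with x h1 h2 h3
    rw [h3, Pi.sub_apply, h1, h2, Pi.sub_apply, ← ofReal_norm, norm_sub_rev (f n x)]
    exact ENNReal.ofReal_le_ofReal (log_one_add_le_self (norm_nonneg _))

variable [IsProbabilityMeasure μ]

/-- Uniform distance to `H₁` is attained along limits in `L₁`. -/
theorem exists_memFun_near_of_approx {w : S → ℝ} (hw : Integrable w μ) {D : ℝ} (hD : 0 ≤ D)
    (happ : ∀ ε : ℝ, 0 < ε → ∃ (v : S → ℝ) (h : S → ℂ), AEStronglyMeasurable v μ ∧ H.MemFun h ∧
      eLpNorm (v - w) 1 μ ≤ ENNReal.ofReal ε ∧ ∀ᵐ x ∂μ, ‖(v x : ℂ) - h x‖ ≤ D) :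
    ∃ h : S → ℂ, H.MemFun h ∧ Integrable h μ ∧ ∀ᵐ x ∂μ, ‖(w x : ℂ) - h x‖ ≤ D := by
  set ε : ℕ → ℝ := fun n => 1 / ((n : ℝ) + 1) with hε
  have hε0 : ∀ n, 0 < ε n := fun n => by positivity
  have hεanti : Antitone ε := fun n m h => by
    have : (n : ℝ) ≤ m := by exact_mod_cast h
    simp only [hε]
    gcongr
  have hεlim : Tendsto ε atTop (𝓝 0) := tendsto_one_div_add_atTop_nhds_zero_nat
  have hwc : AEStronglyMeasurable (fun x => (w x : ℂ)) μ := hw.ofReal.1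
  -- `T n` collects the corrections `c`, bounded by `D`, for which `w + c` is within `ε n` of `H` in
  -- `L₁`. These sets are convex and decreasing; a common point `b` of their closures makes `w + b`
  -- an `L₁` limit of elements of `H`.
  set T : ℕ → Set (Lp ℂ 2 μ) := fun n => {c | (∀ᵐ x ∂μ, ‖c x‖ ≤ D) ∧ ∃ h : S → ℂ, H.MemFun h ∧
    eLpNorm (fun x => h x - (w x + c x)) 1 μ ≤ ENNReal.ofReal (ε n)} with hT
  have hTanti : Antitone T := fun n m hnm c ⟨h1, h, h2, h3⟩ =>
    ⟨h1, h, h2, h3.trans (ENNReal.ofReal_le_ofReal (hεanti hnm))⟩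
  have hne : ∀ n, (T n).Nonempty := by
    intro n
    obtain ⟨v, h, hv, hh, h1, h2⟩ := happ (ε n) (hε0 n)
    have hvc : AEStronglyMeasurable (fun x => (v x : ℂ)) μ :=
      Complex.continuous_ofReal.comp_aestronglyMeasurable hv
    have hc : MemLp (fun x => h x - v x) 2 μ := by
      refine MemLp.of_bound (hh.aestronglyMeasurable.sub hvc) D ?_
      filter_upwards [h2] with x hx
      rwa [norm_sub_rev]
    refine ⟨hc.toLp _, ?_, h, hh, (le_of_eq ?_).trans h1⟩
    · filter_upwards [hc.coeFn_toLp, h2] with x h3 h4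
      rwa [h3, norm_sub_rev]
    · refine eLpNorm_congr_norm_ae ?_
      filter_upwards [hc.coeFn_toLp] with x h3
      rw [h3, Pi.sub_apply, ← Complex.norm_real]
      congr 1
      push_cast
      ring
  have hconv : ∀ n, Convex ℝ (T n) := by
    rintro n c ⟨hc1, h, hh, hc2⟩ c' ⟨hc1', h', hh', hc2'⟩ a b ha hb hab
    have hcoe : ∀ᵐ x ∂μ, (a • c + b • c' : Lp ℂ 2 μ) x = a * c x + b * c' x := by
      filter_upwards [Lp.coeFn_add (a • c) (b • c'), Lp.coeFn_smul a c, Lp.coeFn_smul b c']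
        with x h1 h2 h3
      rw [h1, Pi.add_apply, h2, h3, Pi.smul_apply, Pi.smul_apply, Complex.real_smul,
        Complex.real_smul]
    refine ⟨?_, fun x => a * h x + b * h' x, (hh.const_mul a).add (hh'.const_mul b), ?_⟩
    · filter_upwards [hcoe, hc1, hc1'] with x h1 h2 h3
      rw [h1]
      refine (norm_add_le _ _).trans ?_
      rw [norm_mul, norm_mul, Complex.norm_real, Complex.norm_real, Real.norm_of_nonneg ha,
        Real.norm_of_nonneg hb]
      calc a * ‖c x‖ + b * ‖c' x‖ ≤ a * D + b * D := by gcongr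
        _ = D := by rw [← add_mul, hab, one_mul]
    · have e : (fun x => (a * h x + b * h' x) - (w x + (a • c + b • c' : Lp ℂ 2 μ) x))
          =ᵐ[μ] (a : ℂ) • (fun x => h x - (w x + c x)) + (b : ℂ) • fun x => h' x - (w x + c' x) := by
        have hab' : (a : ℂ) + b = 1 := by exact_mod_cast hab
        filter_upwards [hcoe] with x h1
        rw [h1, Pi.add_apply, Pi.smul_apply, Pi.smul_apply, smul_eq_mul, smul_eq_mul]
        linear_combination (w x : ℂ) * hab'
      have hm : ∀ (c : Lp ℂ 2 μ) (h : S → ℂ), H.MemFun h →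
          AEStronglyMeasurable (fun x => h x - (w x + c x)) μ := fun c h hh =>
        hh.aestronglyMeasurable.sub (hwc.add (Lp.aestronglyMeasurable c))
      rw [eLpNorm_congr_ae e]
      refine (eLpNorm_add_le ((hm c h hh).const_smul _) ((hm c' h' hh').const_smul _)
        le_rfl).trans ?_
      rw [eLpNorm_const_smul, eLpNorm_const_smul, ← ofReal_norm, ← ofReal_norm, Complex.norm_real,
        Complex.norm_real, Real.norm_of_nonneg ha, Real.norm_of_nonneg hb]
      calc _ ≤ ENNReal.ofReal a * ENNReal.ofReal (ε n) + ENNReal.ofReal b * ENNReal.ofReal (ε n) := by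
            gcongr
        _ = ENNReal.ofReal (ε n) := by
            rw [← add_mul, ← ENNReal.ofReal_add ha hb, hab, ENNReal.ofReal_one, one_mul]
  obtain ⟨b, hb⟩ := exists_forall_mem_closure_of_antitone hTanti hne hconv
    (r := _) fun n c hc => Lp.norm_le_of_ae_bound hD hc.1
  have hstep : ∀ n, ∃ c ∈ T n, dist b c < ε n := fun n =>
    Metric.mem_closure_iff.1 (hb n) _ (hε0 n)
  choose c hcT hcb using hstep
  have hclim : Tendsto c atTop (𝓝 b) := by
    rw [tendsto_iff_dist_tendsto_zero]
    refine squeeze_zero (fun n => dist_nonneg) (fun n => ?_) hεlim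
    rw [dist_comm]
    exact (hcb n).le
  have hbD : ∀ᵐ x ∂μ, ‖b x‖ ≤ D := by
    obtain ⟨ns, -, hns⟩ := (tendstoInMeasure_of_tendsto_Lp hclim).exists_seq_tendsto_ae
    filter_upwards [hns, ae_all_iff.2 fun n => (hcT n).1] with x h1 h2
    exact le_of_tendsto h1.norm (Eventually.of_forall fun n => h2 _)
  have hi : Integrable (fun x => (w x : ℂ) + b x) μ :=
    hw.ofReal.add ((Lp.memLp b).integrable (by norm_num))
  choose h hhH hhw using fun n => (hcT n).2
  refine ⟨fun x => w x + b x, memFun_of_tendsto_eLpNorm_one hhH hi ?_, hi, ?_⟩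
  · have h1 : Tendsto (fun n => ENNReal.ofReal (ε n) + ENNReal.ofReal (ε n)) atTop (𝓝 0) := by
      have := ENNReal.tendsto_ofReal hεlim
      simpa using this.add this
    refine tendsto_of_tendsto_of_tendsto_of_le_of_le tendsto_const_nhds h1 (fun n => zero_le)
      fun n => ?_
    have hm1 : AEStronglyMeasurable (fun x => h n x - (w x + c n x)) μ :=
      (hhH n).aestronglyMeasurable.sub (hwc.add (Lp.aestronglyMeasurable _))
    have e : h n - (fun x => (w x : ℂ) + b x)
        = (fun x => h n x - (w x + c n x)) + (⇑(c n) - ⇑b) := by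
      ext x
      simp only [Pi.sub_apply, Pi.add_apply]
      ring
    rw [e]
    refine (eLpNorm_add_le hm1 ((Lp.aestronglyMeasurable _).sub (Lp.aestronglyMeasurable _))
      le_rfl).trans (add_le_add (hhw n) ?_)
    refine (eLpNorm_le_eLpNorm_of_exponent_le (q := 2) (by norm_num)
      ((Lp.aestronglyMeasurable _).sub (Lp.aestronglyMeasurable _))).trans ?_
    rw [← eLpNorm_congr_ae (Lp.coeFn_sub (c n) b), ← Lp.enorm_def, ← ofReal_norm, ← dist_eq_norm,
      dist_comm]
    exact ENNReal.ofReal_le_ofReal (hcb n).le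
  · filter_upwards [hbD] with x hx
    simpa using hx

end ClosedSubalgebra

/-! ### Weighted operator norms in terms of weighted integrals. -/

theorem sqInt_const (f : Lp ℂ 2 μ) {c : ℝ} (hc : 0 ≤ c) :
    sqInt f (fun _ => c) = ENNReal.ofReal c * ENNReal.ofReal (‖f‖ ^ 2) := by
  rw [← sqInt_eq_ofReal_norm_sq (f := f) (F := f) (ω := fun _ => 1)
    (Eventually.of_forall fun x => mul_one _), ← sqInt_const_mul _ hc]
  simp

theorem sqInt_add_weight (f : Lp ℂ 2 μ) {ω ω' : S → ℝ} (hω : AEMeasurable ω μ)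
    (h0 : ∀ x, 0 ≤ ω x) (h0' : ∀ x, 0 ≤ ω' x) :
    sqInt f (fun x => ω x + ω' x) = sqInt f ω + sqInt f ω' := by
  rw [sqInt, sqInt, sqInt, ← lintegral_add_left'
    (aemeasurable_enorm_sq_mul (Lp.aestronglyMeasurable f) hω)]
  refine lintegral_congr fun x => ?_
  rw [ENNReal.ofReal_add (h0 x) (h0' x), mul_add]

theorem sqInt_add_le (f g : Lp ℂ 2 μ) {ω : S → ℝ} (hω : AEMeasurable ω μ) (h0 : ∀ x, 0 ≤ ω x) :
    sqInt (f + g) ω ≤ ENNReal.ofReal 2 * sqInt f ω + ENNReal.ofReal 2 * sqInt g ω := by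
  rw [← sqInt_const_mul f (by norm_num), ← sqInt_const_mul g (by norm_num), sqInt, sqInt, sqInt,
    ← lintegral_add_left' (aemeasurable_enorm_sq_mul (Lp.aestronglyMeasurable f)
      (hω.const_mul 2))]
  refine lintegral_mono_ae ?_
  filter_upwards [Lp.coeFn_add f g] with x hx
  rw [hx, Pi.add_apply, enorm_sq_mul_ofReal, enorm_sq_mul_ofReal, enorm_sq_mul_ofReal,
    ← ENNReal.ofReal_add (by have := h0 x; positivity) (by have := h0 x; positivity)]
  refine ENNReal.ofReal_le_ofReal ?_
  have h1 := norm_add_le (f x) (g x)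
  have h2 : ‖f x + g x‖ ^ 2 ≤ 2 * ‖f x‖ ^ 2 + 2 * ‖g x‖ ^ 2 := by
    nlinarith [norm_nonneg (f x + g x), sq_nonneg (‖f x‖ - ‖g x‖)]
  nlinarith [h0 x]

theorem sqInt_const_smul (c : ℂ) (f : Lp ℂ 2 μ) (ω : S → ℝ) :
    sqInt (c • f) ω = ‖c‖ₑ ^ 2 * sqInt f ω := by
  rw [sqInt, sqInt, ← lintegral_const_mul' _ _ (by simp)]
  refine lintegral_congr_ae ?_
  filter_upwards [Lp.coeFn_smul c f] with x hx
  rw [hx, Pi.smul_apply, smul_eq_mul, enorm_mul, mul_pow, mul_assoc]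

theorem weightedNorm_eq (w : S → ℝ) (f : Lp ℂ 2 μ) :
    weightedNorm w f = sqInt f (fun x => Real.exp (w x)) ^ (1 / 2 : ℝ) := rfl

theorem weightedNorm_le_ofReal_iff {w : S → ℝ} {f : Lp ℂ 2 μ} {r : ℝ} (hr : 0 ≤ r) :
    weightedNorm w f ≤ ENNReal.ofReal r ↔
      sqInt f (fun x => Real.exp (w x)) ≤ ENNReal.ofReal (r ^ 2) := by
  rw [weightedNorm_eq, one_div, ENNReal.rpow_inv_le_iff (by norm_num),
    ENNReal.ofReal_rpow_of_nonneg hr (by norm_num)]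
  norm_num

theorem weightedOpNorm_le_of_sqInt_le {T : Lp ℂ 2 μ →L[ℂ] Lp ℂ 2 μ} {w : S → ℝ} {M : ℝ}
    (hM : 0 ≤ M) (h : ∀ f : Lp ℂ 2 μ, sqInt (T f) (fun x => Real.exp (w x))
      ≤ ENNReal.ofReal (M ^ 2) * sqInt f (fun x => Real.exp (w x))) :
    weightedOpNorm T w ≤ ENNReal.ofReal M := by
  refine iSup₂_le fun f hf => ?_
  rw [← ENNReal.ofReal_one, weightedNorm_le_ofReal_iff zero_le_one, one_pow,
    ENNReal.ofReal_one] at hf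
  rw [weightedNorm_le_ofReal_iff hM]
  calc _ ≤ _ := h f
    _ ≤ ENNReal.ofReal (M ^ 2) * 1 := by gcongr
    _ = _ := mul_one _

/-- Homogeneity: `f` is divided by `r` whenever `r²` bounds its weighted integral `q`. Taking `r² =
q + δ` and letting `δ → 0` covers `q = 0`, where normalization is impossible; for `q = ∞` the right
side is infinite since `M > 0`. -/
theorem sqInt_le_of_weightedOpNorm_le {T : Lp ℂ 2 μ →L[ℂ] Lp ℂ 2 μ} {w : S → ℝ} {M : ℝ}
    (hM : 0 < M) (h : weightedOpNorm T w ≤ ENNReal.ofReal M) (f : Lp ℂ 2 μ) :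
    sqInt (T f) (fun x => Real.exp (w x))
      ≤ ENNReal.ofReal (M ^ 2) * sqInt f (fun x => Real.exp (w x)) := by
  have key : ∀ r : ℝ, 0 < r → sqInt f (fun x => Real.exp (w x)) ≤ ENNReal.ofReal (r ^ 2) →
      sqInt (T f) (fun x => Real.exp (w x)) ≤ ENNReal.ofReal (M ^ 2 * r ^ 2) := by
    intro r hr hfr
    have hrn : ‖((r⁻¹ : ℝ) : ℂ)‖ₑ ^ 2 = ENNReal.ofReal (r⁻¹ ^ 2) := by
      rw [← ofReal_norm, Complex.norm_real, Real.norm_of_nonneg (by positivity),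
        ENNReal.ofReal_pow (by positivity)]
    have h1 : weightedNorm w (((r⁻¹ : ℝ) : ℂ) • f) ≤ 1 := by
      rw [← ENNReal.ofReal_one, weightedNorm_le_ofReal_iff zero_le_one, sqInt_const_smul, hrn]
      calc _ ≤ ENNReal.ofReal (r⁻¹ ^ 2) * ENNReal.ofReal (r ^ 2) := by gcongr
        _ = _ := by
          rw [← ENNReal.ofReal_mul (by positivity), ← mul_pow, inv_mul_cancel₀ hr.ne']
    have h2 := (le_iSup₂_of_le (f := fun f (_ : weightedNorm w f ≤ 1) => weightedNorm w (T f))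
      _ h1 le_rfl).trans h
    rw [weightedNorm_le_ofReal_iff hM.le, map_smul, sqInt_const_smul, hrn] at h2
    calc sqInt (T f) (fun x => Real.exp (w x))
        = ENNReal.ofReal (r ^ 2) * (ENNReal.ofReal (r⁻¹ ^ 2) *
            sqInt (T f) (fun x => Real.exp (w x))) := by
          rw [← mul_assoc, ← ENNReal.ofReal_mul (by positivity), ← mul_pow,
            mul_inv_cancel₀ hr.ne', one_pow, ENNReal.ofReal_one, one_mul]
      _ ≤ ENNReal.ofReal (r ^ 2) * ENNReal.ofReal (M ^ 2) := by gcongr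
      _ = _ := by rw [← ENNReal.ofReal_mul (by positivity), mul_comm]
  by_cases htop : sqInt f (fun x => Real.exp (w x)) = ∞
  · rw [htop, ENNReal.mul_top]
    · exact le_top
    · simp only [ne_eq, ENNReal.ofReal_eq_zero, not_le]
      positivity
  · set q := (sqInt f (fun x => Real.exp (w x))).toReal with hq
    have hq0 : 0 ≤ q := ENNReal.toReal_nonneg
    have hqe : sqInt f (fun x => Real.exp (w x)) = ENNReal.ofReal q :=
      (ENNReal.ofReal_toReal htop).symm
    rw [hqe, ← ENNReal.ofReal_mul (by positivity)]
    have hc : Continuous fun δ : ℝ => ENNReal.ofReal (M ^ 2 * (q + δ)) :=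
      ENNReal.continuous_ofReal.comp (by fun_prop)
    have hlim : Tendsto (fun δ : ℝ => ENNReal.ofReal (M ^ 2 * (q + δ))) (𝓝[>] 0)
        (𝓝 (ENNReal.ofReal (M ^ 2 * q))) := by
      simpa using (hc.tendsto 0).mono_left nhdsWithin_le_nhds
    refine ge_of_tendsto hlim ?_
    filter_upwards [self_mem_nhdsWithin] with δ hδ
    have hδ : 0 < δ := hδ
    have h1 := key (Real.sqrt (q + δ)) (Real.sqrt_pos.2 (by linarith))
    rw [Real.sq_sqrt (by linarith)] at h1
    exact h1 (hqe.le.trans (ENNReal.ofReal_le_ofReal (by linarith)))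

/-! ### Truncation of the weight and both directions for a fixed weight. -/

namespace ClosedSubalgebra

variable {H : ClosedSubalgebra μ}

theorem memBMO_of_near {w : S → ℝ} (hw : AEStronglyMeasurable w μ) {h : S → ℂ} (hh : H.MemFun h)
    (hi : Integrable h μ) {D : ℝ} (hD : ∀ᵐ x ∂μ, ‖(w x : ℂ) - h x‖ ≤ D) : H.MemBMO w := by
  obtain ⟨F, hF, hFh⟩ := hh
  refine ⟨F, fun x => w x - F x, ⟨hF, hi.congr hFh.symm⟩, ?_, ?_⟩
  · refine memLp_top_of_bound
      ((Complex.continuous_ofReal.comp_aestronglyMeasurable hw).sub F.aestronglyMeasurable) D ?_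
    filter_upwards [hD, hFh] with x h1 h2
    rwa [h2]
  · exact Eventually.of_forall fun x => by ring

theorem bmoNorm_le_of_near {w : S → ℝ} {h : S → ℂ} (hh : H.MemFun h)
    (hi : Integrable h μ) {D : ℝ} (hD : ∀ᵐ x ∂μ, ‖(w x : ℂ) - h x‖ ≤ D) :
    H.bmoNorm w ≤ ENNReal.ofReal D := by
  obtain ⟨F, hF, hFh⟩ := hh
  refine iInf₂_le_of_le F ⟨hF, hi.congr hFh.symm⟩ ?_
  rw [eLpNorm_exponent_top]
  refine eLpNormEssSup_le_of_ae_bound ?_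
  filter_upwards [hD, hFh] with x h1 h2
  rwa [h2]

variable [IsProbabilityMeasure μ]

theorem norm_riesz_le (f : Lp ℂ 2 μ) : ‖H.riesz f‖ ≤ ‖f‖ :=
  Submodule.norm_starProjection_apply_le _ _

theorem sqInt_riesz_const_le (f : Lp ℂ 2 μ) {c : ℝ} (hc : 0 ≤ c) :
    sqInt (H.riesz f) (fun _ => c) ≤ sqInt f (fun _ => c) := by
  rw [sqInt_const _ hc, sqInt_const _ hc]
  gcongr
  exact norm_riesz_le f

/-- Boundedness of `ℛ` on `L₂(ω)` passes to truncations of the weight. -/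
theorem sqInt_riesz_truncation_le {ω : S → ℝ} (hω : AEMeasurable ω μ) (h0 : ∀ x, 0 ≤ ω x) {A : ℝ}
    (hA : 1 ≤ A)
    (hR : ∀ f : Lp ℂ 2 μ, sqInt (H.riesz f) ω ≤ ENNReal.ofReal A * sqInt f ω)
    {N δ : ℝ} (hN : 0 ≤ N) (hδ : 0 ≤ δ) (f : Lp ℂ 2 μ) :
    sqInt (H.riesz f) (fun x => min (ω x) N + δ)
      ≤ ENNReal.ofReal (2 * A) * sqInt f (fun x => min (ω x) N + δ) := by
  have hE : NullMeasurableSet {x | ω x ≤ N} μ := nullMeasurableSet_le hω aemeasurable_const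
  set E := {x | ω x ≤ N} with hEdef
  have hmin : AEMeasurable (fun x => min (ω x) N) μ := hω.min aemeasurable_const
  have hmin0 : ∀ x, 0 ≤ min (ω x) N := fun x => le_min (h0 x) hN
  have hm1 : MemLp (E.indicator f) 2 μ :=
    (Lp.memLp f).of_le ((Lp.aestronglyMeasurable f).indicator₀ hE)
      (Eventually.of_forall fun x => norm_indicator_le_norm_self _ _)
  set f₁ := hm1.toLp _ with hf₁
  have hfx : ∀ᵐ x ∂μ, (f₁ x = if ω x ≤ N then f x else 0) ∧
      (f - f₁ : Lp ℂ 2 μ) x = if ω x ≤ N then 0 else f x := by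
    filter_upwards [hm1.coeFn_toLp, Lp.coeFn_sub f f₁] with x h1 h2
    rw [h2, Pi.sub_apply, hf₁, h1]
    by_cases h : ω x ≤ N <;> simp [Set.indicator, hEdef, h]
  -- The truncated weight is `ω` on the support of `f₁` and the constant `N` on that of `f - f₁`.
  -- The hypothesis handles the first piece and contractivity of `ℛ` on unweighted `L₂` the second;
  -- the factor 2 comes from `|a + b|² ≤ 2|a|² + 2|b|²`.
  have hsplit : sqInt f₁ ω + sqInt (f - f₁) (fun _ => N) = sqInt f (fun x => min (ω x) N) := by
    rw [sqInt, sqInt, sqInt, ← lintegral_add_left'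
      (aemeasurable_enorm_sq_mul (Lp.aestronglyMeasurable _) hω)]
    refine lintegral_congr_ae ?_
    filter_upwards [hfx] with x ⟨h1, h2⟩
    rw [h1, h2]
    by_cases h : ω x ≤ N
    · simp [h]
    · simp [h, min_eq_right (not_le.1 h).le]
  have hmain : sqInt (H.riesz f) (fun x => min (ω x) N)
      ≤ ENNReal.ofReal (2 * A) * sqInt f (fun x => min (ω x) N) := by
    have e : H.riesz f = H.riesz f₁ + H.riesz (f - f₁) := by rw [← map_add, add_sub_cancel]
    rw [e, ENNReal.ofReal_mul (by norm_num), ← hsplit, mul_assoc, mul_add, mul_add]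
    refine (sqInt_add_le _ _ hmin hmin0).trans (add_le_add ?_ ?_)
    · gcongr
      exact (sqInt_mono (Eventually.of_forall fun x => min_le_left _ _)).trans (hR _)
    · gcongr
      refine (sqInt_mono (Eventually.of_forall fun x => min_le_right _ _)).trans
        ((sqInt_riesz_const_le _ hN).trans ?_)
      exact le_mul_of_one_le_left zero_le (ENNReal.one_le_ofReal.2 hA)
  rw [sqInt_add_weight _ hmin hmin0 (fun _ => hδ), sqInt_add_weight _ hmin hmin0 (fun _ => hδ),
    mul_add]
  refine add_le_add hmain ((sqInt_riesz_const_le _ hδ).trans ?_)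
  exact le_mul_of_one_le_left zero_le (ENNReal.one_le_ofReal.2 (by linarith))

/-- A bound independent of `N`, so that the logarithms of the truncated weights have an integrable
majorant when `w ∈ L₁`. -/
theorem abs_log_min_exp_add_le (t : ℝ) {N : ℝ} (hN : 1 ≤ N) :
    |Real.log (min (Real.exp t) N + N⁻¹)| ≤ |t| + Real.log 2 := by
  have hN0 : 0 < N⁻¹ := by positivity
  have hN1 : N⁻¹ ≤ 1 := inv_le_one_of_one_le₀ hN
  have hl2 : 0 ≤ Real.log 2 := Real.log_nonneg (by norm_num)
  have hpos : 0 < min (Real.exp t) N := lt_min (Real.exp_pos t) (by linarith)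
  rw [abs_le]
  constructor
  · have h1 : Real.exp (-|t|) ≤ min (Real.exp t) N + N⁻¹ := by
      have h2 : Real.exp (-|t|) ≤ Real.exp t := Real.exp_le_exp.2 (neg_abs_le t)
      have h3 : Real.exp (-|t|) ≤ N := (Real.exp_le_one_iff.2 (by simp)).trans hN
      linarith [le_min h2 h3]
    have := (Real.le_log_iff_exp_le (by linarith)).2 h1
    linarith
  · rw [Real.log_le_iff_le_exp (by linarith), Real.exp_add, Real.exp_log (by norm_num)]
    have h2 : Real.exp t ≤ Real.exp |t| := Real.exp_le_exp.2 (le_abs_self t)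
    have h3 : 1 ≤ Real.exp |t| := Real.one_le_exp (abs_nonneg t)
    linarith [min_le_left (Real.exp t) N]

theorem tendsto_log_min_exp_add (t : ℝ) :
    Tendsto (fun n : ℕ => Real.log (min (Real.exp t) (n + 1) + (n + 1 : ℝ)⁻¹)) atTop (𝓝 t) := by
  have h1 : Tendsto (fun n : ℕ => min (Real.exp t) (n + 1 : ℝ)) atTop (𝓝 (Real.exp t)) := by
    refine tendsto_const_nhds.congr' ?_
    obtain ⟨N, hN⟩ := exists_nat_ge (Real.exp t)
    filter_upwards [eventually_ge_atTop N] with n hn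
    have : (N : ℝ) ≤ n := by exact_mod_cast hn
    rw [min_eq_left (by linarith)]
  have h2 : Tendsto (fun n : ℕ => (n + 1 : ℝ)⁻¹) atTop (𝓝 0) := by
    simpa using tendsto_one_div_add_atTop_nhds_zero_nat (𝕜 := ℝ)
  have h3 := h1.add h2
  rw [add_zero] at h3
  have h4 := (Real.continuousAt_log (Real.exp_pos t).ne').tendsto.comp h3
  rwa [Real.log_exp] at h4

/-- If `ℛ` is bounded on `L₂(e^w)`, then `w` is uniformly close to an element of `H₁`. -/
theorem exists_memFun_near_of_sqInt_riesz_le (hD : H.IsDirichletType) {w : S → ℝ}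
    (hw : Integrable w μ) {A : ℝ} (hA : 1 ≤ A)
    (hR : ∀ f : Lp ℂ 2 μ, sqInt (H.riesz f) (fun x => Real.exp (w x))
      ≤ ENNReal.ofReal A * sqInt f (fun x => Real.exp (w x))) :
    ∃ h : S → ℂ, H.MemFun h ∧ Integrable h μ ∧
      ∀ᵐ x ∂μ, ‖(w x : ℂ) - h x‖ ≤ logDist (2 * A) := by
  have hexp : AEMeasurable (fun x => Real.exp (w x)) μ :=
    Real.measurable_exp.comp_aemeasurable hw.1.aemeasurable
  set ω : ℕ → S → ℝ := fun n x => min (Real.exp (w x)) (n + 1) + (n + 1 : ℝ)⁻¹ with hω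
  have hωm : ∀ n, AEMeasurable (ω n) μ := fun n => (hexp.min aemeasurable_const).add_const _
  have hlogm : ∀ n, AEStronglyMeasurable (fun x => Real.log (ω n x)) μ := fun n =>
    (Real.measurable_log.comp_aemeasurable (hωm n)).aestronglyMeasurable
  have hlim : Tendsto (fun n => eLpNorm ((fun x => Real.log (ω n x)) - w) 1 μ) atTop (𝓝 0) := by
    simp only [eLpNorm_one_eq_lintegral_enorm]
    have h1 := tendsto_lintegral_of_dominated_convergence' (μ := μ)
      (F := fun n x => ‖((fun x => Real.log (ω n x)) - w) x‖ₑ) (f := fun _ => 0)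
      (fun x => ENNReal.ofReal (|w x| + Real.log 2 + |w x|))
      (fun n => ((hlogm n).sub hw.1).enorm) (fun n => ?_) ?_ ?_
    · simpa using h1
    · refine Eventually.of_forall fun x => ?_
      dsimp only
      rw [← ofReal_norm]
      refine ENNReal.ofReal_le_ofReal ((norm_sub_le _ _).trans ?_)
      rw [Real.norm_eq_abs, Real.norm_eq_abs]
      gcongr
      exact abs_log_min_exp_add_le (w x) (by simp)
    · exact (Integrable.lintegral_lt_top
        ((hw.abs.add (integrable_const _)).add hw.abs)).ne
    · refine Eventually.of_forall fun x => ?_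
      have h2 := ((tendsto_log_min_exp_add (w x)).sub_const (w x)).enorm
      simpa using h2
  refine exists_memFun_near_of_approx hw (logDist_nonneg (by linarith)) fun ε hε => ?_
  obtain ⟨n, hn⟩ := (hlim.eventually (gt_mem_nhds (ENNReal.ofReal_pos.2 hε))).exists
  have hn0 : (0 : ℝ) < (n + 1 : ℝ)⁻¹ := by positivity
  obtain ⟨h, hh, hnear⟩ := exists_memFun_near_log hD (hωm n) (m := (n + 1 : ℝ)⁻¹)
    (B := (n + 1) + (n + 1 : ℝ)⁻¹) (A := 2 * A) hn0
    (Eventually.of_forall fun x => le_add_of_nonneg_left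
      (le_min (Real.exp_pos _).le (by positivity)))
    (Eventually.of_forall fun x => by simp only [hω]; gcongr; exact min_le_right _ _)
    (by linarith)
    (sqInt_riesz_truncation_le hexp (fun x => (Real.exp_pos _).le) hA hR (by positivity) hn0.le)
  exact ⟨fun x => Real.log (ω n x), h, hlogm n, hh, hn.le, hnear⟩

theorem exists_memFun_near_of_weightedOpNorm_le (hD : H.IsDirichletType) {w : S → ℝ}
    (hw : Integrable w μ) {M : ℝ} (hM : 1 ≤ M)
    (h : weightedOpNorm H.riesz w ≤ ENNReal.ofReal M) :
    ∃ h : S → ℂ, H.MemFun h ∧ Integrable h μ ∧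
      ∀ᵐ x ∂μ, ‖(w x : ℂ) - h x‖ ≤ logDist (2 * M ^ 2) :=
  exists_memFun_near_of_sqInt_riesz_le hD hw (by nlinarith)
    (sqInt_le_of_weightedOpNorm_le (by linarith) h)

/-- Dividing by `t ≥ 4β` brings `w / t` within the tolerance 1/4 of `h / t ∈ H₁`. -/
theorem weightedOpNorm_riesz_div_le {h : S → ℂ} (hh : H.MemFun h) (hi : Integrable h μ)
    {w : S → ℝ} (hw : AEMeasurable w μ) {β t : ℝ} (ht : 0 < t) (hβ : 4 * β ≤ t)
    (hwh : ∀ᵐ x ∂μ, ‖(w x : ℂ) - h x‖ ≤ β) :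
    weightedOpNorm H.riesz (fun x => w x / t) ≤ ENNReal.ofReal (Real.exp 1) := by
  refine weightedOpNorm_le_of_sqInt_le (Real.exp_pos 1).le
    (sqInt_riesz_le_of_norm_sub_le (hh.const_mul (t : ℂ)⁻¹) (hi.const_mul _) (hw.div_const t) ?_)
  filter_upwards [hwh] with x hx
  have e : ((w x / t : ℝ) : ℂ) - (t : ℂ)⁻¹ * h x = (t : ℂ)⁻¹ * (w x - h x) := by
    push_cast
    ring
  rw [e, norm_mul, norm_inv, Complex.norm_real, Real.norm_of_nonneg ht.le, inv_mul_le_iff₀ ht]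
  linarith

end ClosedSubalgebra

end HardyWeights

end

/-! ### The equivalence and the comparison of norms. -/

open HardyWeights ClosedSubalgebra in
theorem proposition5p4 :
    ∃ C : ℝ≥0, 0 < C ∧
      ∀ (S : Type*) [TopologicalSpace S] [PolishSpace S] [MeasurableSpace S] [BorelSpace S]
        (μ : Measure S) [IsProbabilityMeasure μ] (H : HardyWeights.ClosedSubalgebra μ),
        H.IsDirichletType →
        ∀ w : S → ℝ, Integrable w μ →
          (H.MemBMO w ↔ HardyWeights.IsWeightDirection H.riesz w) ∧
          (H.MemBMO w →
            (C : ℝ≥0∞)⁻¹ * H.bmoNorm w ≤ HardyWeights.weightDirectionNorm H.riesz w ∧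
            HardyWeights.weightDirectionNorm H.riesz w ≤ (C : ℝ≥0∞) * H.bmoNorm w) := by
  have he : 1 ≤ Real.exp 1 := Real.one_le_exp zero_le_one
  set L := logDist (2 * Real.exp 1 ^ 2) with hL
  -- The 4 is the reciprocal of the tolerance 1/4 in the sufficiency estimate; `L` is the distance
  -- obtained when the operator norm is at most `e`, the 2 accounting for truncation of the weight.
  refine ⟨max 4 L.toNNReal, by simp, ?_⟩
  intro S _ _ _ _ μ _ H hD w hw
  set C : ℝ≥0 := max 4 L.toNNReal with hC
  have hC0 : (C : ℝ≥0∞) ≠ 0 := by simp [hC]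
  have hbound : ∀ (F : S →ₘ[μ] ℂ), eLpNorm (fun x => (w x : ℂ) - F x) ∞ μ ≠ ∞ →
      ∀ᵐ x ∂μ, ‖(w x : ℂ) - F x‖ ≤ (eLpNorm (fun x => (w x : ℂ) - F x) ∞ μ).toReal := by
    intro F hF
    rw [eLpNorm_exponent_top] at hF ⊢
    filter_upwards [ae_le_eLpNormEssSup (f := fun x => (w x : ℂ) - F x) (μ := μ)] with x hx
    rw [← ofReal_norm] at hx
    exact (ENNReal.ofReal_le_iff_le_toReal hF).1 hx
  refine ⟨⟨?_, ?_⟩, fun _ => ⟨?_, ?_⟩⟩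
  · rintro ⟨F, b, ⟨hF, hFi⟩, hb, hwb⟩
    have hfin : eLpNorm (fun x => (w x : ℂ) - F x) ∞ μ ≠ ∞ := by
      rw [eLpNorm_congr_ae (g := b)]
      · exact hb.2.ne
      · filter_upwards [hwb] with x hx
        rw [hx]; ring
    have hnear := hbound F hfin
    set β := (eLpNorm (fun x => (w x : ℂ) - F x) ∞ μ).toReal
    have hβ : 0 ≤ β := ENNReal.toReal_nonneg
    refine ⟨(4 * β + 1)⁻¹, by positivity, lt_of_le_of_lt (b := ENNReal.ofReal (Real.exp 1)) ?_
      ENNReal.ofReal_lt_top⟩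
    have h1 := weightedOpNorm_riesz_div_le (memFun_coe.2 hF) hFi hw.1.aemeasurable
      (t := 4 * β + 1) (by positivity) (by linarith) hnear
    simpa only [div_eq_inv_mul] using h1
  · rintro ⟨α, hα, hop⟩
    -- The maximum with 1 secures the condition `M ≥ 1`, required for `ρ` to make sense.
    set M := max 1 (weightedOpNorm H.riesz fun x => α * w x).toReal with hM
    have hM1 : weightedOpNorm H.riesz (fun x => α * w x) ≤ ENNReal.ofReal M :=
      (ENNReal.ofReal_toReal hop.ne).ge.trans (ENNReal.ofReal_le_ofReal (le_max_right _ _))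
    obtain ⟨h, hh, hi, hn⟩ := exists_memFun_near_of_weightedOpNorm_le hD (hw.const_mul α)
      (le_max_left _ _) hM1
    refine memBMO_of_near hw.1 (hh.const_mul (α : ℂ)⁻¹) (hi.const_mul _)
      (D := α⁻¹ * logDist (2 * M ^ 2)) ?_
    filter_upwards [hn] with x hx
    have hα' : (α : ℂ) ≠ 0 := by exact_mod_cast hα.ne'
    have e : (w x : ℂ) - (α : ℂ)⁻¹ * h x = (α : ℂ)⁻¹ * ((α * w x : ℝ) - h x) := by
      push_cast
      field_simp
    rw [e, norm_mul, norm_inv, Complex.norm_real, Real.norm_of_nonneg hα.le]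
    gcongr
  · rw [ENNReal.inv_mul_le_iff hC0 ENNReal.coe_ne_top]
    rw [weightDirectionNorm, ENNReal.mul_iInf_of_ne hC0 ENNReal.coe_ne_top]
    refine le_iInf fun t => ?_
    rw [ENNReal.mul_iInf_of_ne hC0 ENNReal.coe_ne_top]
    refine le_iInf fun ⟨ht, hop⟩ => ?_
    obtain ⟨h, hh, hi, hn⟩ := exists_memFun_near_of_weightedOpNorm_le hD (hw.div_const t) he hop
    refine (bmoNorm_le_of_near (hh.const_mul t) (hi.const_mul _) (D := L * t) ?_).trans ?_
    · filter_upwards [hn] with x hx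
      have ht' : (t : ℂ) ≠ 0 := by exact_mod_cast ht.ne'
      have e : (w x : ℂ) - t * h x = t * ((w x / t : ℝ) - h x) := by
        push_cast
        field_simp
      rw [e, norm_mul, Complex.norm_real, Real.norm_of_nonneg ht.le, mul_comm L]
      gcongr
    · rw [ENNReal.ofReal_mul (logDist_nonneg (by nlinarith))]
      gcongr
      exact ENNReal.coe_le_coe.2 (le_max_right _ _)
  · rw [bmoNorm, ENNReal.mul_iInf_of_ne hC0 ENNReal.coe_ne_top]
    refine le_iInf fun F => ?_
    rw [ENNReal.mul_iInf_of_ne hC0 ENNReal.coe_ne_top]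
    refine le_iInf fun ⟨hF, hFi⟩ => ?_
    by_cases hfin : eLpNorm (fun x => (w x : ℂ) - F x) ∞ μ = ∞
    · rw [hfin, ENNReal.mul_top hC0]
      exact le_top
    · have hnear := hbound F hfin
      set β := (eLpNorm (fun x => (w x : ℂ) - F x) ∞ μ).toReal with hβdef
      have hβ : 0 ≤ β := ENNReal.toReal_nonneg
      -- The values `t = 4β + δ` are used because the infimum runs over positive `t` only and `β`
      -- may vanish.
      have h1 : weightDirectionNorm H.riesz w ≤ ENNReal.ofReal (4 * β) := by
        have hlim : Filter.Tendsto (fun δ : ℝ => ENNReal.ofReal (4 * β + δ)) (nhdsWithin 0 (Set.Ioi 0))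
            (nhds (ENNReal.ofReal (4 * β))) := by
          have hc : Continuous fun δ : ℝ => ENNReal.ofReal (4 * β + δ) :=
            ENNReal.continuous_ofReal.comp (by fun_prop)
          simpa using (hc.tendsto 0).mono_left nhdsWithin_le_nhds
        refine ge_of_tendsto hlim ?_
        filter_upwards [self_mem_nhdsWithin] with δ hδ
        have hδ : 0 < δ := hδ
        exact iInf₂_le _ ⟨by positivity, weightedOpNorm_riesz_div_le (memFun_coe.2 hF) hFi
          hw.1.aemeasurable (by positivity) (by linarith) hnear⟩
      refine h1.trans ?_
      rw [ENNReal.ofReal_mul (by norm_num), hβdef, ENNReal.ofReal_toReal hfin]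
      gcongr
      rw [ENNReal.ofReal_ofNat]
      exact_mod_cast le_max_left (4 : ℝ≥0) L.toNNReal
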